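/- Let $(M,g)$ be a nonempty smooth Riemannian manifold of dimension $n\ge 2$, with Levi-Civita connection $\dot\nabla$, and let $TM$ be its tangent bundle. For $y\in TM$ put $t=\tfrac12 g(y,y)\in[0,\infty)$, and denote by $X^H_y$, $X^V_y$ the horizontal (with respect to $\dot\nabla$) and vertical lifts to $T_yTM$ of a tangent vector $X$ of $M$ at the base point of $y$. Let $a_1,\dots,a_4,b_1,\dots,b_4,c_1,c_2,c_3,d_1,d_2,d_3$ be smooth functions of $t\in[0,\infty)$ and define on $TM$ $$JX^H_y=a_1X^V_y+b_1g(X,y)y^V_y+a_4X^H_y+b_4g(X,y)y^H_y,\qquad JX^V_y=a_3X^V_y+b_3g(X,y)y^V_y-a_2X^H_y-b_2g(X,y)y^H_y,$$ $$G(X^H_y,Y^H_y)=c_1g(X,Y)+d_1g(X,y)g(Y,y),\quad G(X^V_y,Y^V_y)=c_2g(X,Y)+d_2g(X,y)g(Y,y),$$ $$G(X^V_y,Y^H_y)=G(Y^H_y,X^V_y)=c_3g(X,Y)+d_3g(X,y)g(Y,y).$$ Assume that $(G,J)$ is an almost anti-Hermitian structure on $TM$, i.e. $J^2=-\mathrm{id}$,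 $G$ is nondegenerate and $G(JX,JY)=-G(X,Y)$. Let $\nabla$ be the Levi-Civita connection of $G$ and $F(X,Y,Z)=G((\nabla_XJ)Y,Z)$. Assume also that $c_1(1+a_3^2)-a_1a_3c_3\neq 0$ for every $t\ge 0$. Then $(TM,G,J)$ is quasi-anti-Kähler, i.e. $F(X,Y,Z)+F(Y,Z,X)+F(Z,X,Y)=0$ for all $X,Y,Z$, if and only if there is a real constant $c$ such that $(M,g)$ has constant sectional curvature $c$ and, for every $t\ge 0$ (with $'=d/dt$), $$c_1'=-\frac{2(a_1d_1+2b_3cc_3t)}{a_1+2b_1t},\qquad d_1'=\frac{2(b_3cc_3-b_1d_1)}{a_1+2b_1t},$$ $$a_1'=\frac{1}{[c_1(1+a_3^2)-a_1a_3c_3](a_1+2b_1t)}\Big\{a_1\big[b_1c_1(1+a_3^2+2a_3a_3't)+2(1+a_3^2)cc_3(a_3-b_3t)\big]-(1+a_3^2)^2cc_1-a_1^3\big[(a_3'-b_3)c_3+a_3c_3'\big]-a_1^2\big[2d_1+a_3(2b_1c_3+2a_3d_1-a_3'c_1)+2b_1(a_3'c_3+a_3c_3')t\big]\Big\},$$ $$a_3'=\frac{1}{E\,(a_1+2b_1t)}\Big\{-a_1(1+a_3^2)\big[b_3(c_1^2+2cc_3^2t+4c_1d_1t)+2c_1\big(a_3d_1-b_1(c_3+2d_3t)\big)\big]+2a_1^2\big[c_1d_3-c_3d_1+a_3^2(c_3d_1+c_1d_3)-a_3c_3\big(b_1(c_3+2d_3t)-2b_3d_1t\big)\big]+\frac{a_1^4c_3(b_3c_3-2a_3d_3)-2(1+a_3^2)b_3cc_1t\,[c_1(1+a_3^2)-2a_1a_3c_3]}{a_1}\Big\},$$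 where $E=(1+a_3^2)c_1^2-a_1c_3(2a_3c_1-a_1c_3)$, $$c_3'=\frac{2(1+a_3^2)b_3cc_1t}{a_1^2(a_1+2b_1t)}+\frac{a_1(b_3c_1-b_1c_3-2a_3d_1)+cc_3(1+a_3^2-4a_3b_3t)}{a_1(a_1+2b_1t)},$$ $$d_3'=\frac{a_3'd_1-a_1'd_3+b_3'(c_1+2d_1t)-b_1'(c_3+2d_3t)+b_1c_3'-b_3c_1'-2(a_3+2b_3t)d_1'-2b_3d_1-4b_1d_3}{a_1+2b_1t}-\frac{2b_3cc_1(1+a_3^2)}{a_1^2(a_1+2b_1t)}-\frac{2cc_3\,[b_1(1+a_3^2)-4a_3b_3(a_1+b_1t)-2a_1b_3^2t]}{a_1(a_1+2b_1t)^2}.$$ The remaining denominators $a_1$, $a_1+2b_1t$ and $E$ never vanish under these assumptions. -/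

import Mathlib

open scoped Manifold ContDiff Topology

set_option maxSynthPendingDepth 3

noncomputable section

namespace NaturalLift

/-! ### Semi-Riemannian geometry in a chart

A semi-Riemannian metric on an open subset of a finite-dimensional vector space `V` is given by
its coefficient field `h : V → V →L[ℝ] V →L[ℝ] ℝ`. -/

section Chart

variable {V : Type*} [NormedAddCommGroup V] [NormedSpace ℝ V]

/-- The (lowered) Christoffel symbols of the first kind, times two:
`koszul h p u v w = (D_u h)(v, w) + (D_v h)(u, w) - (D_w h)(u, v)` at the point `p`. -/
def koszul (h : V → V →L[ℝ] V →L[ℝ] ℝ) (p : V) : V →L[ℝ] V →L[ℝ] V →L[ℝ] ℝ :=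
  let D : V →L[ℝ] V →L[ℝ] V →L[ℝ] ℝ := fderiv ℝ h p
  let flip : (V →L[ℝ] V →L[ℝ] ℝ) →L[ℝ] V →L[ℝ] V →L[ℝ] ℝ :=
    (ContinuousLinearMap.flipₗᵢ ℝ V V ℝ).toContinuousLinearEquiv
  D + D.flip - flip.comp D.flip

theorem koszul_apply (h : V → V →L[ℝ] V →L[ℝ] ℝ) (p u v w : V) :
    koszul h p u v w =
      fderiv ℝ h p u v w + fderiv ℝ h p v u w - fderiv ℝ h p w u v := rfl

/-- The Christoffel symbols (of the second kind) of the Levi-Civita connection of `h`: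
`christoffel h p u v` is the vector `Γ(u, v)` with `2 h(Γ(u, v), w) = koszul h p u v w`. -/
def christoffel (h : V → V →L[ℝ] V →L[ℝ] ℝ) (p : V) : V →L[ℝ] V →L[ℝ] V :=
  (ContinuousLinearMap.compL ℝ V (V →L[ℝ] ℝ) V ((1 / 2 : ℝ) • (h p).inverse)) ∘L koszul h p

theorem christoffel_apply (h : V → V →L[ℝ] V →L[ℝ] ℝ) (p u v : V) :
    christoffel h p u v = (1 / 2 : ℝ) • (h p).inverse (koszul h p u v) := rfl

/-- For a nondegenerate metric, `christoffel` satisfies the Koszul formula. -/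
theorem two_mul_christoffel (h : V → V →L[ℝ] V →L[ℝ] ℝ) (p u v w : V)
    (hp : (h p).IsInvertible) :
    2 * h p (christoffel h p u v) w = koszul h p u v w := by
  have key : h p ((h p).inverse (koszul h p u v)) = koszul h p u v :=
    congrArg (fun f : (V →L[ℝ] ℝ) →L[ℝ] (V →L[ℝ] ℝ) => f (koszul h p u v)) hp.self_comp_inverse
  rw [christoffel_apply, map_smul, key]
  simp

/-- The curvature tensor `R(u, v) w = ∇_u ∇_v w - ∇_v ∇_u w - ∇_[u, v] w` of the Levi-Civita
connection of `h`, for the constant vector fields `u, v, w`. -/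
def curvature (h : V → V →L[ℝ] V →L[ℝ] ℝ) (p u v w : V) : V :=
  fderiv ℝ (christoffel h) p u v w - fderiv ℝ (christoffel h) p v u w +
    christoffel h p u (christoffel h p v w) - christoffel h p v (christoffel h p u w)

/-- The covariant derivative `(∇_u J) v` of a field `J` of endomorphisms, with respect to the
Levi-Civita connection of `h`. -/
def nablaEndo (h : V → V →L[ℝ] V →L[ℝ] ℝ) (J : V → V →L[ℝ] V) (p u v : V) : V :=
  fderiv ℝ J p u v + christoffel h p u (J p v) - J p (christoffel h p u v)

/-- The tensor field `F(u, v, w) = h((∇_u J) v, w)`. -/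
def tensorF (h : V → V →L[ℝ] V →L[ℝ] ℝ) (J : V → V →L[ℝ] V) (p u v w : V) : ℝ :=
  h p (nablaEndo h J p u v) w

end Chart

/-! ### Natural lifts to the tangent bundle, in an induced chart -/

/-- The coefficient functions of a natural tensor field `J` of type `(1,1)` and of a natural
symmetric tensor field `G` of type `(0,2)` on the tangent bundle.  They are functions of the
energy density `t = g(y, y) / 2`; only their values for `t ≥ 0` matter. -/
structure Coeffs where
  a1 : ℝ → ℝ
  a2 : ℝ → ℝ
  a3 : ℝ → ℝ
  a4 : ℝ → ℝ
  b1 : ℝ → ℝ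
  b2 : ℝ → ℝ
  b3 : ℝ → ℝ
  b4 : ℝ → ℝ
  c1 : ℝ → ℝ
  c2 : ℝ → ℝ
  c3 : ℝ → ℝ
  d1 : ℝ → ℝ
  d2 : ℝ → ℝ
  d3 : ℝ → ℝ

/-- All the coefficients are smooth functions on `[0, ∞)`. -/
structure Coeffs.Smooth (K : Coeffs) : Prop where
  a1 : ContDiffOn ℝ ∞ K.a1 (Set.Ici 0)
  a2 : ContDiffOn ℝ ∞ K.a2 (Set.Ici 0)
  a3 : ContDiffOn ℝ ∞ K.a3 (Set.Ici 0)
  a4 : ContDiffOn ℝ ∞ K.a4 (Set.Ici 0)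
  b1 : ContDiffOn ℝ ∞ K.b1 (Set.Ici 0)
  b2 : ContDiffOn ℝ ∞ K.b2 (Set.Ici 0)
  b3 : ContDiffOn ℝ ∞ K.b3 (Set.Ici 0)
  b4 : ContDiffOn ℝ ∞ K.b4 (Set.Ici 0)
  c1 : ContDiffOn ℝ ∞ K.c1 (Set.Ici 0)
  c2 : ContDiffOn ℝ ∞ K.c2 (Set.Ici 0)
  c3 : ContDiffOn ℝ ∞ K.c3 (Set.Ici 0)
  d1 : ContDiffOn ℝ ∞ K.d1 (Set.Ici 0)
  d2 : ContDiffOn ℝ ∞ K.d2 (Set.Ici 0)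
  d3 : ContDiffOn ℝ ∞ K.d3 (Set.Ici 0)

/-- The derivative of a function of `t ∈ [0, ∞)` (one-sided at `t = 0`). -/
def ddt (f : ℝ → ℝ) (t : ℝ) : ℝ := derivWithin f (Set.Ici 0) t

section Lift

/-! Here `g` is the coefficient field of a Riemannian metric in a chart with values in `E`; a point
of the induced chart of the tangent bundle is a pair `p = (x, y)`, the point `x` of the chart and
the components `y` of the tangent vector, and tangent vectors to the tangent bundle are pairs of
`E × E`. -/

variable {E : Type*} [NormedAddCommGroup E] [NormedSpace ℝ E]

/-- The energy density `t = g(y, y) / 2`. -/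
def energy (g : E → E →L[ℝ] E →L[ℝ] ℝ) (p : E × E) : ℝ := g p.1 p.2 p.2 / 2

/-- The vertical lift `X ↦ X^V = X^i ∂/∂y^i`. -/
def vlift : E →L[ℝ] E × E := ContinuousLinearMap.inr ℝ E E

/-- The horizontal lift `X ↦ X^H = X^i (∂/∂x^i - Γ^h_{ki} y^k ∂/∂y^h)`. -/
def hlift (g : E → E →L[ℝ] E →L[ℝ] ℝ) (p : E × E) : E →L[ℝ] E × E :=
  (ContinuousLinearMap.id ℝ E).prod (-(christoffel g p.1 p.2))

/-- The horizontal component of a tangent vector: `ξ = (hpart ξ)^H + (vpart ξ)^V`. -/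
def hpart : E × E →L[ℝ] E := ContinuousLinearMap.fst ℝ E E

/-- The vertical component of a tangent vector: `ξ = (hpart ξ)^H + (vpart ξ)^V`. -/
def vpart (g : E → E →L[ℝ] E →L[ℝ] ℝ) (p : E × E) : E × E →L[ℝ] E :=
  ContinuousLinearMap.snd ℝ E E + christoffel g p.1 p.2 ∘L ContinuousLinearMap.fst ℝ E E

theorem hlift_hpart_add_vlift_vpart (g : E → E →L[ℝ] E →L[ℝ] ℝ) (p ξ : E × E) :
    hlift g p (hpart ξ) + vlift (vpart g p ξ) = ξ := by
  ext <;> simp [hlift, hpart, vlift, vpart]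

/-- The endomorphism `X ↦ a X + b g(X, y) y`. -/
def endo (g : E → E →L[ℝ] E →L[ℝ] ℝ) (p : E × E) (a b : ℝ) : E →L[ℝ] E :=
  a • ContinuousLinearMap.id ℝ E + b • (g p.1 p.2).smulRight p.2

/-- The bilinear form `(X, Y) ↦ c g(X, Y) + d g(X, y) g(Y, y)`. -/
def form (g : E → E →L[ℝ] E →L[ℝ] ℝ) (p : E × E) (c d : ℝ) : E →L[ℝ] E →L[ℝ] ℝ :=
  c • g p.1 + d • (g p.1 p.2).smulRight (g p.1 p.2)

/-- The natural tensor field `J` of type `(1,1)`: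
`J X^H = a₁ X^V + b₁ g(X, y) y^V + a₄ X^H + b₄ g(X, y) y^H`,
`J X^V = a₃ X^V + b₃ g(X, y) y^V - a₂ X^H - b₂ g(X, y) y^H`,
the coefficients being taken at `t = g(y, y) / 2`. -/
def liftJ (K : Coeffs) (g : E → E →L[ℝ] E →L[ℝ] ℝ) (p : E × E) : E × E →L[ℝ] E × E :=
  let t := energy g p
  (vlift ∘L endo g p (K.a1 t) (K.b1 t) + hlift g p ∘L endo g p (K.a4 t) (K.b4 t)) ∘L hpart +
    (vlift ∘L endo g p (K.a3 t) (K.b3 t) - hlift g p ∘L endo g p (K.a2 t) (K.b2 t)) ∘L vpart g p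

/-- The natural symmetric tensor field `G` of type `(0,2)`:
`G(X^H, Y^H) = c₁ g(X, Y) + d₁ g(X, y) g(Y, y)`,
`G(X^V, Y^V) = c₂ g(X, Y) + d₂ g(X, y) g(Y, y)`,
`G(X^V, Y^H) = G(Y^H, X^V) = c₃ g(X, Y) + d₃ g(X, y) g(Y, y)`,
the coefficients being taken at `t = g(y, y) / 2`. -/
def liftG (K : Coeffs) (g : E → E →L[ℝ] E →L[ℝ] ℝ) (p : E × E) :
    E × E →L[ℝ] E × E →L[ℝ] ℝ :=
  let t := energy g p
  (form g p (K.c1 t) (K.d1 t)).bilinearComp hpart hpart +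
    (form g p (K.c2 t) (K.d2 t)).bilinearComp (vpart g p) (vpart g p) +
    (form g p (K.c3 t) (K.d3 t)).bilinearComp (vpart g p) hpart +
    (form g p (K.c3 t) (K.d3 t)).bilinearComp hpart (vpart g p)

end Lift

/-! ### The manifold and its tangent bundle -/

section Manifold

variable {E : Type*} [NormedAddCommGroup E] [NormedSpace ℝ E]
  {M : Type*} [TopologicalSpace M] [ChartedSpace E M] [IsManifold 𝓘(ℝ, E) ∞ M]

/-- The coefficients of a Riemannian metric `g` on `M` in a chart `φ` of `M`. -/
def metricInChart
    (g : Bundle.ContMDiffRiemannianMetric 𝓘(ℝ, E) ∞ E (fun x : M => TangentSpace 𝓘(ℝ, E) x))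
    (φ : OpenPartialHomeomorph M E) (x : E) : E →L[ℝ] E →L[ℝ] ℝ :=
  let gx : E →L[ℝ] E →L[ℝ] ℝ := g.inner (φ.symm x)
  let dφ : E →L[ℝ] E := mfderiv 𝓘(ℝ, E) 𝓘(ℝ, E) φ.symm x
  gx.bilinearComp dφ dφ

theorem metricInChart_apply
    (g : Bundle.ContMDiffRiemannianMetric 𝓘(ℝ, E) ∞ E (fun x : M => TangentSpace 𝓘(ℝ, E) x))
    (φ : OpenPartialHomeomorph M E) (x u v : E) :
    metricInChart g φ x u v =
      g.inner (φ.symm x) (mfderiv 𝓘(ℝ, E) 𝓘(ℝ, E) φ.symm x u)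
        (mfderiv 𝓘(ℝ, E) 𝓘(ℝ, E) φ.symm x v) := rfl

/-- `(M, g)` has constant sectional curvature `c`:
`g(R(u, v) v, u) = c (g(u, u) g(v, v) - g(u, v)²)` for all tangent vectors `u, v`. -/
def HasConstantSectionalCurvature
    (g : Bundle.ContMDiffRiemannianMetric 𝓘(ℝ, E) ∞ E (fun x : M => TangentSpace 𝓘(ℝ, E) x))
    (c : ℝ) : Prop :=
  ∀ φ ∈ IsManifold.maximalAtlas 𝓘(ℝ, E) ∞ M, ∀ x ∈ φ.target, ∀ u v : E,
    let h := metricInChart g φ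
    h x (curvature h x u v v) u = c * (h x u u * h x v v - h x u v ^ 2)

/-- The pair `(G, J)` of natural lifts with coefficients `K` is an almost anti-Hermitian structure
on the tangent bundle: `J` is an almost complex structure, `G` is nondegenerate and
`G(J ξ, J η) = -G(ξ, η)`.  These properties are expressed in the charts of the tangent bundle
induced from the charts `φ` of `M`. -/
structure IsAlmostAntiHermitian
    (g : Bundle.ContMDiffRiemannianMetric 𝓘(ℝ, E) ∞ E (fun x : M => TangentSpace 𝓘(ℝ, E) x))
    (K : Coeffs) : Prop where
  sq_J : ∀ φ ∈ IsManifold.maximalAtlas 𝓘(ℝ, E) ∞ M, ∀ x ∈ φ.target, ∀ y : E, ∀ ξ : E × E,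
    liftJ K (metricInChart g φ) (x, y) (liftJ K (metricInChart g φ) (x, y) ξ) = -ξ
  nondegenerate : ∀ φ ∈ IsManifold.maximalAtlas 𝓘(ℝ, E) ∞ M, ∀ x ∈ φ.target, ∀ y : E,
    ∀ ξ : E × E, (∀ η : E × E, liftG K (metricInChart g φ) (x, y) ξ η = 0) → ξ = 0
  antiHermitian : ∀ φ ∈ IsManifold.maximalAtlas 𝓘(ℝ, E) ∞ M, ∀ x ∈ φ.target, ∀ y : E,
    ∀ ξ η : E × E,
    liftG K (metricInChart g φ) (x, y)
        (liftJ K (metricInChart g φ) (x, y) ξ) (liftJ K (metricInChart g φ) (x, y) η) =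
      -liftG K (metricInChart g φ) (x, y) ξ η

/-- `(TM, G, J)` is quasi-anti-Kähler: the cyclic sum of the tensor field
`F(X, Y, Z) = G((∇_X J) Y, Z)` vanishes, `∇` being the Levi-Civita connection of `G`. -/
def IsQuasiAntiKahler
    (g : Bundle.ContMDiffRiemannianMetric 𝓘(ℝ, E) ∞ E (fun x : M => TangentSpace 𝓘(ℝ, E) x))
    (K : Coeffs) : Prop :=
  ∀ φ ∈ IsManifold.maximalAtlas 𝓘(ℝ, E) ∞ M, ∀ x ∈ φ.target, ∀ y : E, ∀ ξ η ζ : E × E,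
    let F := tensorF (liftG K (metricInChart g φ)) (liftJ K (metricInChart g φ)) (x, y)
    F ξ η ζ + F η ζ ξ + F ζ ξ η = 0

end Manifold

/-! ### The differential relations between the coefficients -/

/-- The expressions of the first order derivatives `a1', a3', c1', c3', d1', d3'` at `t` in terms
of the coefficients (and of `b1', b3'`), for a base manifold of constant sectional curvature `c`. -/
structure QuasiRelations
    (a1 a3 b1 b3 c1 c3 d1 d3 a1' a3' b1' b3' c1' c3' d1' d3' c t : ℝ) : Prop where
  c1_eq : c1' = -(2 * (a1 * d1 + 2 * b3 * c * c3 * t)) / (a1 + 2 * b1 * t)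
  d1_eq : d1' = 2 * (b3 * c * c3 - b1 * d1) / (a1 + 2 * b1 * t)
  a1_eq : a1' =
    a1 * (b1 * c1 * (1 + a3 ^ 2 + 2 * a3 * a3' * t)
        + 2 * (1 + a3 ^ 2) * c * c3 * (a3 - b3 * t))
      / ((c1 * (1 + a3 ^ 2) - a1 * a3 * c3) * (a1 + 2 * b1 * t))
    - ((1 + a3 ^ 2) ^ 2 * c * c1 + a1 ^ 3 * ((a3' - b3) * c3 + a3 * c3'))
      / ((c1 * (1 + a3 ^ 2) - a1 * a3 * c3) * (a1 + 2 * b1 * t))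
    - a1 ^ 2 * (2 * d1 + a3 * (2 * b1 * c3 + 2 * a3 * d1 - a3' * c1)
        + 2 * b1 * (a3' * c3 + a3 * c3') * t)
      / ((c1 * (1 + a3 ^ 2) - a1 * a3 * c3) * (a1 + 2 * b1 * t))
  a3_eq : a3' =
    -(a1 * (1 + a3 ^ 2) * (b3 * (c1 ^ 2 + 2 * c * c3 ^ 2 * t + 4 * c1 * d1 * t)
        + 2 * c1 * (a3 * d1 - b1 * (c3 + 2 * d3 * t))))
      / (((1 + a3 ^ 2) * c1 ^ 2 - a1 * c3 * (2 * a3 * c1 - a1 * c3)) * (a1 + 2 * b1 * t))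
    + 2 * a1 ^ 2 * (c1 * d3 - c3 * d1 + a3 ^ 2 * (c3 * d1 + c1 * d3)
        - a3 * c3 * (b1 * (c3 + 2 * d3 * t) - 2 * b3 * d1 * t))
      / (((1 + a3 ^ 2) * c1 ^ 2 - a1 * c3 * (2 * a3 * c1 - a1 * c3)) * (a1 + 2 * b1 * t))
    + (a1 ^ 4 * c3 * (b3 * c3 - 2 * a3 * d3)
        - 2 * (1 + a3 ^ 2) * b3 * c * c1 * t * (c1 * (1 + a3 ^ 2) - 2 * a1 * a3 * c3))
      / (a1 * ((1 + a3 ^ 2) * c1 ^ 2 - a1 * c3 * (2 * a3 * c1 - a1 * c3)) * (a1 + 2 * b1 * t))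
  c3_eq : c3' =
    2 * (1 + a3 ^ 2) * b3 * c * c1 * t / (a1 ^ 2 * (a1 + 2 * b1 * t))
    + (a1 * (b3 * c1 - b1 * c3 - 2 * a3 * d1) + c * c3 * (1 + a3 ^ 2 - 4 * a3 * b3 * t))
      / (a1 * (a1 + 2 * b1 * t))
  d3_eq : d3' =
    (a3' * d1 - a1' * d3 + b3' * (c1 + 2 * d1 * t) - b1' * (c3 + 2 * d3 * t)
        + b1 * c3' - b3 * c1' - 2 * (a3 + 2 * b3 * t) * d1' - 2 * b3 * d1 - 4 * b1 * d3)
      / (a1 + 2 * b1 * t)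
    - 2 * b3 * c * c1 * (1 + a3 ^ 2) / (a1 ^ 2 * (a1 + 2 * b1 * t))
    - 2 * c * c3 * (b1 * (1 + a3 ^ 2) - 4 * a3 * b3 * (a1 + b1 * t) - 2 * a1 * b3 ^ 2 * t)
      / (a1 * (a1 + 2 * b1 * t) ^ 2)

/-- The relations `QuasiRelations` for the coefficient functions `K` at the parameter `t`. -/
def Coeffs.SatisfiesQuasiRelations (K : Coeffs) (c t : ℝ) : Prop :=
  QuasiRelations (K.a1 t) (K.a3 t) (K.b1 t) (K.b3 t) (K.c1 t) (K.c3 t) (K.d1 t) (K.d3 t)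
    (ddt K.a1 t) (ddt K.a3 t) (ddt K.b1 t) (ddt K.b3 t)
    (ddt K.c1 t) (ddt K.c3 t) (ddt K.d1 t) (ddt K.d3 t) c t

end NaturalLift

end

/-! Since $J^2=-1$ and $G(J\cdot,J\cdot)=-G$, the endomorphism $J$ is self-adjoint for $G$, hence so
is $\nabla_XJ$, and $F$ is symmetric in its last two arguments. The cyclic sum of $F$ is then a
symmetric trilinear form, so it vanishes exactly when $F(u,u,u)=0$ for all $u$
(`cyclic_sum_eq_zero_iff`).

On the diagonal the Koszul formula gives $F(u,u,u)=(D_{Ju}G)(u,u)+G((D_uJ)u,u)-(D_uG)(Ju,u)$ for the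
flat derivative $D$ of the chart. Replacing $D$ by the connection `conn` induced by the horizontal
distribution costs a torsion term, which is the curvature of the base (`conn_sub_conn`). In
exchange, $g$ becomes parallel, so that only the dependence of $G$ and $J$ on $y$ is differentiated
(`dG`, `dJ`).

Every $u$ is $X^H+JW^H$, because $X\mapsto a_1X+b_1g(X,y)y$ is invertible. Differentiating the two
anti-Hermitian identities removes the derivatives of the remaining coefficients, and $F(u,u,u)$
becomes an explicit cubic polynomial in $X,W$ plus one curvature term (`tensorF_diag_eq_cubicForm`).

If this polynomial vanishes, taking $y=\sqrt s\,X$, dividing by $\sqrt s$ and letting $s\to0$ leaves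
an identity at $t=0$ whose part even in $W$ expresses $g(R(X,W)X,W)$ through coefficient values at
$0$ only (`curvature_of_cubicForm`). The sectional curvature is therefore a constant that does not
depend on the point or the plane. This uses neither Schur's lemma nor connectedness, and it includes
$n=2$.

For constant curvature the cubic form is a combination of six scalar residuals
(`cubicForm_eq_of_curvature_eq`). Testing on $y$ and a vector orthogonal to $y$ shows that they
vanish for $t>0$, and continuity adds $t=0$. They are equivalent to the stated formulas by
elimination (`cyclicRelations_iff`), and the converse reads the same identities backwards. -/

namespace NaturalLift

/-! ### Levi-Civita connection and curvature symmetries in a chart. -/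

section ChartGeometry

variable {V : Type*} [NormedAddCommGroup V] [NormedSpace ℝ V]
  {h : V → V →L[ℝ] V →L[ℝ] ℝ} {p : V}

theorem hasFDerivAt_apply_const {X W : Type*} [NormedAddCommGroup X] [NormedSpace ℝ X]
    [NormedAddCommGroup W] [NormedSpace ℝ W] {f : V → X →L[ℝ] W} {f' : V →L[ℝ] X →L[ℝ] W}
    (hf : HasFDerivAt f f' p) (v : X) :
    HasFDerivAt (fun q => f q v) ((ContinuousLinearMap.apply ℝ W v).comp f') p :=
  (ContinuousLinearMap.hasFDerivAt (ContinuousLinearMap.apply ℝ W v)).comp p hf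

theorem hasFDerivAt_bilin_apply {W : Type*} [NormedAddCommGroup W] [NormedSpace ℝ W]
    {f : V → V →L[ℝ] V →L[ℝ] W} (hd : DifferentiableAt ℝ f p)
    (v w : V) : HasFDerivAt (fun q => f q v w)
      ((ContinuousLinearMap.apply ℝ W w).comp
        ((ContinuousLinearMap.apply ℝ (V →L[ℝ] W) v).comp (fderiv ℝ f p))) p :=
  hasFDerivAt_apply_const (hasFDerivAt_apply_const hd.hasFDerivAt v) w

theorem fderiv_bilin_apply (hd : DifferentiableAt ℝ h p) (u v w : V) :
    fderiv ℝ h p u v w = fderiv ℝ (fun q => h q v w) p u := by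
  rw [(hasFDerivAt_bilin_apply hd v w).fderiv]
  rfl

theorem fderiv_bilin_symm (hd : DifferentiableAt ℝ h p)
    (hs : ∀ᶠ q in 𝓝 p, ∀ v w, h q v w = h q w v) (u v w : V) :
    fderiv ℝ h p u v w = fderiv ℝ h p u w v := by
  rw [fderiv_bilin_apply hd, fderiv_bilin_apply hd]
  congr 1
  apply Filter.EventuallyEq.fderiv_eq
  filter_upwards [hs] with q hq using hq v w

theorem christoffel_symm (hd : DifferentiableAt ℝ h p)
    (hs : ∀ᶠ q in 𝓝 p, ∀ v w, h q v w = h q w v) (u v : V) :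
    christoffel h p u v = christoffel h p v u := by
  have : koszul h p u v = koszul h p v u := by
    ext w
    rw [koszul_apply, koszul_apply, fderiv_bilin_symm hd hs w u v]
    ring
  rw [christoffel_apply, christoffel_apply, this]

theorem fderiv_eq_christoffel (hd : DifferentiableAt ℝ h p)
    (hs : ∀ᶠ q in 𝓝 p, ∀ v w, h q v w = h q w v) (hp : (h p).IsInvertible) (u v w : V) :
    fderiv ℝ h p u v w = h p (christoffel h p u v) w + h p v (christoffel h p u w) := by
  have h1 := two_mul_christoffel h p u v w hp
  have h2 := two_mul_christoffel h p u w v hp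
  rw [koszul_apply] at h1 h2
  rw [hs.self_of_nhds v]
  have := fderiv_bilin_symm hd hs u v w
  have := fderiv_bilin_symm hd hs w u v
  have := fderiv_bilin_symm hd hs v u w
  linarith

theorem differentiableAt_christoffel [CompleteSpace V] (hc : ContDiffAt ℝ 2 h p)
    (hp : (h p).IsInvertible) : DifferentiableAt ℝ (christoffel h) p := by
  have h1 : DifferentiableAt ℝ (fderiv ℝ h) p :=
    (hc.fderiv_right (m := 1) (by norm_num)).differentiableAt (by norm_num)
  have h2 : DifferentiableAt ℝ (fun q => (h q).inverse) p :=
    (hp.contDiffAt_map_inverse (n := 1)).differentiableAt (by norm_num) |>.comp p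
      (hc.differentiableAt (by norm_num))
  let flip : (V →L[ℝ] V →L[ℝ] ℝ) →L[ℝ] V →L[ℝ] V →L[ℝ] ℝ :=
    (ContinuousLinearMap.flipₗᵢ ℝ V V ℝ).toContinuousLinearEquiv
  let flip' : (V →L[ℝ] V →L[ℝ] V →L[ℝ] ℝ) →L[ℝ] V →L[ℝ] V →L[ℝ] V →L[ℝ] ℝ :=
    (ContinuousLinearMap.flipₗᵢ ℝ V V (V →L[ℝ] ℝ)).toContinuousLinearEquiv
  have h3 : DifferentiableAt ℝ (koszul h) p := by
    have : koszul h = fun q => fderiv ℝ h q + flip' (fderiv ℝ h q) -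
      flip.comp (flip' (fderiv ℝ h q)) := rfl
    rw [this]
    fun_prop
  have : christoffel h = fun q =>
    (ContinuousLinearMap.compL ℝ V (V →L[ℝ] ℝ) V ((1 / 2 : ℝ) • (h q).inverse)).comp
      (koszul h q) := rfl
  rw [this]
  fun_prop

/-- Metric compatibility, $(D_vh)(w,w)=2h(\Gamma(v,w),w)$, holds near `p` and is differentiated once
more along `u`. -/
theorem fderiv_fderiv_eq (hc : ContDiffAt ℝ 2 h p)
    (hs : ∀ᶠ q in 𝓝 p, ∀ v w, h q v w = h q w v)
    (hi : ∀ᶠ q in 𝓝 p, (h q).IsInvertible) (hΓ : DifferentiableAt ℝ (christoffel h) p)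
    (u v w : V) :
    fderiv ℝ (fderiv ℝ h) p u v w w = 2 * (h p (christoffel h p u (christoffel h p v w)) w
      + h p (christoffel h p v w) (christoffel h p u w)
      + h p (fderiv ℝ (christoffel h) p u v w) w) := by
  have hd : DifferentiableAt ℝ h p := hc.differentiableAt (by norm_num)
  have hd' : DifferentiableAt ℝ (fderiv ℝ h) p :=
    (hc.fderiv_right (m := 1) (by norm_num)).differentiableAt (by norm_num)
  have hev : ∀ᶠ q in 𝓝 p, DifferentiableAt ℝ h q := by
    filter_upwards [hc.eventually (by simp)] with q hq using hq.differentiableAt (by norm_num)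
  have e1 : (fun q => fderiv ℝ h q v w w) =ᶠ[𝓝 p] fun q => 2 * h q (christoffel h q v w) w := by
    filter_upwards [hev, hi, eventually_eventually_nhds.2 hs] with q h1 h2 h3
    rw [fderiv_eq_christoffel h1 h3 h2, h3.self_of_nhds w]
    ring
  have d1 : HasFDerivAt (fun q => fderiv ℝ h q v w w)
      ((ContinuousLinearMap.apply ℝ ℝ w).comp ((ContinuousLinearMap.apply ℝ _ w).comp
        ((ContinuousLinearMap.apply ℝ _ v).comp (fderiv ℝ (fderiv ℝ h) p)))) p :=
    hasFDerivAt_apply_const (hasFDerivAt_bilin_apply hd' v w) w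
  have d2 := (((hd.hasFDerivAt.clm_apply (hasFDerivAt_bilin_apply hΓ v w)).clm_apply
    (hasFDerivAt_const w p)).const_mul 2)
  have := congrArg (fun L : V →L[ℝ] ℝ => L u) (d1.fderiv.symm.trans (e1.fderiv_eq.trans d2.fderiv))
  simp at this
  rw [this, fderiv_eq_christoffel hd hs hi.self_of_nhds]
  ring

/-- Antisymmetrizing `fderiv_fderiv_eq` in `u`, `v` produces the curvature on one side and zero on
the other, as second derivatives of `h` commute. -/
theorem curvature_skew_right (hc : ContDiffAt ℝ 2 h p)
    (hs : ∀ᶠ q in 𝓝 p, ∀ v w, h q v w = h q w v)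
    (hi : ∀ᶠ q in 𝓝 p, (h q).IsInvertible) (hΓ : DifferentiableAt ℝ (christoffel h) p)
    (u v w : V) : h p (curvature h p u v w) w = 0 := by
  have h1 := fderiv_fderiv_eq hc hs hi hΓ u v w
  have h2 := fderiv_fderiv_eq hc hs hi hΓ v u w
  have h3 : fderiv ℝ (fderiv ℝ h) p u v = fderiv ℝ (fderiv ℝ h) p v u :=
    (hc.isSymmSndFDerivAt (by simp)) u v
  rw [h3] at h1
  have h4 := hs.self_of_nhds (christoffel h p u w) (christoffel h p v w)
  simp only [curvature, map_add, map_sub, add_apply, sub_apply]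
  linarith

theorem curvature_skew_left (u v w : V) : curvature h p u v w = -curvature h p v u w := by
  simp only [curvature]; abel

theorem curvature_add_third (u v w w' : V) :
    curvature h p u v (w + w') = curvature h p u v w + curvature h p u v w' := by
  simp only [curvature, map_add]; abel

theorem curvature_smul_third (u v w : V) (a : ℝ) :
    curvature h p u v (a • w) = a • curvature h p u v w := by
  simp only [curvature, map_smul, smul_add, smul_sub]

theorem curvature_add_left (u u' v w : V) :
    curvature h p (u + u') v w = curvature h p u v w + curvature h p u' v w := by
  simp only [curvature, map_add, add_apply]; abel

theorem curvature_smul_left (u v w : V) (a : ℝ) :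
    curvature h p (a • u) v w = a • curvature h p u v w := by
  simp only [curvature, map_smul, smul_add, smul_sub, smul_apply]

theorem curvature_add_right (u v v' w : V) :
    curvature h p u (v + v') w = curvature h p u v w + curvature h p u v' w := by
  rw [curvature_skew_left, curvature_add_left, curvature_skew_left u v, curvature_skew_left u v']
  abel

theorem curvature_smul_right (u v w : V) (a : ℝ) :
    curvature h p u (a • v) w = a • curvature h p u v w := by
  rw [curvature_skew_left, curvature_smul_left, curvature_skew_left u v, smul_neg]

theorem curvature_bianchi (hΓs : ∀ᶠ q in 𝓝 p, ∀ u v, christoffel h q u v = christoffel h q v u)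
    (hΓ : DifferentiableAt ℝ (christoffel h) p) (u v w : V) :
    curvature h p u v w + curvature h p v w u + curvature h p w u v = 0 := by
  have key : ∀ a b c, fderiv ℝ (christoffel h) p a b c = fderiv ℝ (christoffel h) p a c b := by
    intro a b c
    have : (fun q => christoffel h q b c) =ᶠ[𝓝 p] fun q => christoffel h q c b := by
      filter_upwards [hΓs] with q hq using hq b c
    have := congrArg (fun L : V →L[ℝ] V => L a) this.fderiv_eq
    rw [(hasFDerivAt_bilin_apply hΓ b c).fderiv, (hasFDerivAt_bilin_apply hΓ c b).fderiv] at this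
    simpa using this
  have s := hΓs.self_of_nhds
  simp only [curvature]
  rw [key u w v, key v u w, key w v u, s w v, s u w, s v u]
  abel

end ChartGeometry

end NaturalLift
namespace NaturalLift

/-! ### The curvature tensor is determined by the sectional curvature. -/

section ConstantCurvature

variable {V : Type*} [NormedAddCommGroup V] [NormedSpace ℝ V]
  {h : V → V →L[ℝ] V →L[ℝ] ℝ} {p : V}

/-- Four instances of the Bianchi identity are added, and skewness in each pair cancels all but the
two terms wanted. -/
theorem curvature_pair_symm
    (hb : ∀ u v w, curvature h p u v w + curvature h p v w u + curvature h p w u v = 0)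
    (hsk : ∀ u v w, h p (curvature h p u v w) w = 0) (u v w z : V) :
    h p (curvature h p u v w) z = h p (curvature h p w z u) v := by
  have B : ∀ a b c d, h p (curvature h p a b c) d + h p (curvature h p b c a) d
      + h p (curvature h p c a b) d = 0 := by
    intro a b c d
    have := congrArg (fun x => h p x d) (hb a b c)
    simpa using this
  have L : ∀ a b c d, h p (curvature h p a b c) d = -h p (curvature h p b a c) d := by
    intro a b c d
    rw [curvature_skew_left, map_neg]
    rfl
  have R : ∀ a b c d, h p (curvature h p a b c) d = -h p (curvature h p a b d) c := by
    intro a b c d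
    have h0 := hsk a b (c + d)
    rw [curvature_add_third] at h0
    simp only [map_add, add_apply, hsk a b c, hsk a b d] at h0
    linarith
  linarith [B u v w z, B v w z u, B w z u v, B z u v w, R v w z u, R w z v u, L u w z v,
    R w u z v, R z u v w, R u v z w, L v z u w, R z v u w]

theorem curvature_eq_of_sectional (hs : ∀ v w, h p v w = h p w v)
    (hp : ∀ v, (∀ w, h p v w = 0) → v = 0)
    (hb : ∀ u v w, curvature h p u v w + curvature h p v w u + curvature h p w u v = 0)
    (hsk : ∀ u v w, h p (curvature h p u v w) w = 0) {c : ℝ}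
    (hc : ∀ u v, h p (curvature h p u v v) u = c * (h p u u * h p v v - h p u v ^ 2)) (u v w : V) :
    curvature h p u v w = c • (h p v w • u - h p u w • v) := by
  -- Polarization of the sectional curvature identity in `u`; pair symmetry makes $(u,w)\mapsto
  -- h(R(u,v)v,w)$ a symmetric form, so its diagonal determines it.
  have h1 : ∀ u v, curvature h p u v v = c • (h p v v • u - h p u v • v) := by
    intro u v
    rw [← sub_eq_zero]
    apply hp
    intro w
    have e1 := hc u v
    have e2 := hc w v
    have e3 := hc (u + w) v
    have e4 := curvature_pair_symm hb hsk u v v w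
    have e5 : h p (curvature h p v w u) v = h p (curvature h p w v v) u := by
      have h0 := hsk v w (u + v)
      rw [curvature_add_third] at h0
      simp only [map_add, add_apply, hsk v w u, hsk v w v] at h0
      rw [curvature_skew_left w v v]
      simp only [map_neg, neg_apply]
      linarith
    rw [curvature_add_left] at e3
    simp only [map_add, add_apply] at e3
    simp only [map_sub, map_smul, sub_apply, smul_apply, smul_eq_mul]
    rw [hs w u] at e3
    rw [hs v w] at *
    linear_combination (1 / 2) * e3 - (1 / 2) * e1 - (1 / 2) * e2 + (1 / 2) * e4 + (1 / 2) * e5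
  have h2 : ∀ u v w, curvature h p u v w + curvature h p u w v
      = c • ((2 * h p v w) • u - h p u v • w - h p u w • v) := by
    intro u v w
    have e1 := h1 u v
    have e2 := h1 u w
    have e3 := h1 u (v + w)
    rw [curvature_add_right, curvature_add_third, curvature_add_third] at e3
    have : curvature h p u v w + curvature h p u w v =
        c • (h p (v + w) (v + w) • u - h p u (v + w) • (v + w)) - curvature h p u v v
          - curvature h p u w w := by rw [← e3]; abel
    rw [this, e1, e2]
    simp only [map_add, add_apply, hs w v]
    module
  have e1 := h2 u v w
  have e2 := h2 v w u
  have e4 := hb u v w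
  rw [curvature_skew_left v u w] at e2
  rw [curvature_skew_left w u v] at e4
  rw [hs w u, hs v u] at e2
  -- `h2` gives the part of $R(u,v)w$ symmetric in the last two slots; two such parts and the
  -- Bianchi identity add up to $3R(u,v)w$.
  have e5 : (3 : ℝ) • curvature h p u v w = (3 : ℝ) • c • (h p v w • u - h p u w • v) := by
    have : (3 : ℝ) • curvature h p u v w =
        (curvature h p u v w + curvature h p u w v)
        - (curvature h p v w u + -curvature h p u v w)
        + (curvature h p u v w + curvature h p v w u + -curvature h p u w v) := by module
    rw [this, e1, e2, e4]
    module
  exact smul_right_injective V (by norm_num : (3 : ℝ) ≠ 0) e5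

end ConstantCurvature

/-! ### The tensor `tensorF` for a self-adjoint `J`, and polarization of its cyclic sum. -/

section CyclicSum

variable {V : Type*} [NormedAddCommGroup V] [NormedSpace ℝ V]
  {h : V → V →L[ℝ] V →L[ℝ] ℝ} {J : V → V →L[ℝ] V} {p : V}

theorem two_mul_tensorF (hp : (h p).IsInvertible) (hJ : ∀ v w, h p (J p v) w = h p v (J p w))
    (u v w : V) :
    2 * tensorF h J p u v w =
      2 * h p (fderiv ℝ J p u v) w + koszul h p u (J p v) w - koszul h p u v (J p w) := by
  rw [← two_mul_christoffel h p u (J p v) w hp, ← two_mul_christoffel h p u v (J p w) hp, ← hJ]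
  simp only [tensorF, nablaEndo, map_add, map_sub, add_apply, sub_apply]
  ring

theorem fderiv_anti_symm (hd : DifferentiableAt ℝ h p) (hJd : DifferentiableAt ℝ J p)
    (hJ : ∀ᶠ q in 𝓝 p, ∀ v w, h q (J q v) w = h q v (J q w)) (u v w : V) :
    fderiv ℝ h p u (J p v) w + h p (fderiv ℝ J p u v) w =
      fderiv ℝ h p u v (J p w) + h p v (fderiv ℝ J p u w) := by
  have d1 := (hd.hasFDerivAt.clm_apply (hasFDerivAt_apply_const hJd.hasFDerivAt v)).clm_apply
    (hasFDerivAt_const w p)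
  have d2 := (hasFDerivAt_apply_const hd.hasFDerivAt v).clm_apply
    (hasFDerivAt_apply_const hJd.hasFDerivAt w)
  have e : (fun q => h q (J q v) w) =ᶠ[𝓝 p] fun q => h q v (J q w) := by
    filter_upwards [hJ] with q hq using hq v w
  have := congrArg (fun L : V →L[ℝ] ℝ => L u) (d1.fderiv.symm.trans (e.fderiv_eq.trans d2.fderiv))
  simp at this
  linarith

theorem fderiv_sq_eq_neg (hJd : DifferentiableAt ℝ J p) (hJ : ∀ᶠ q in 𝓝 p, ∀ v, J q (J q v) = -v)
    (u v : V) : fderiv ℝ J p u (J p v) + J p (fderiv ℝ J p u v) = 0 := by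
  have d1 := hJd.hasFDerivAt.clm_apply (hasFDerivAt_apply_const hJd.hasFDerivAt v)
  have e : (fun q => J q (J q v)) =ᶠ[𝓝 p] fun _ => -v := by
    filter_upwards [hJ] with q hq using hq v
  have := congrArg (fun L : V →L[ℝ] V => L u)
    (d1.fderiv.symm.trans (e.fderiv_eq.trans (hasFDerivAt_const (-v) p).fderiv))
  simp at this
  rw [← this, add_comm]

theorem fderiv_anti_eq_neg (hd : DifferentiableAt ℝ h p) (hJd : DifferentiableAt ℝ J p)
    (hJ : ∀ᶠ q in 𝓝 p, ∀ v w, h q (J q v) (J q w) = -h q v w) (u v w : V) :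
    fderiv ℝ h p u (J p v) (J p w) + h p (fderiv ℝ J p u v) (J p w)
      + h p (J p v) (fderiv ℝ J p u w) = -fderiv ℝ h p u v w := by
  have d1 := (hd.hasFDerivAt.clm_apply (hasFDerivAt_apply_const hJd.hasFDerivAt v)).clm_apply
    (hasFDerivAt_apply_const hJd.hasFDerivAt w)
  have d2 := (hasFDerivAt_bilin_apply hd v w).fun_neg
  have e : (fun q => h q (J q v) (J q w)) =ᶠ[𝓝 p] fun q => -h q v w := by
    filter_upwards [hJ] with q hq using hq v w
  have := congrArg (fun L : V →L[ℝ] ℝ => L u) (d1.fderiv.symm.trans (e.fderiv_eq.trans d2.fderiv))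
  simp at this
  linarith

/-- The metric is parallel, so differentiating $h(Jv,w)=h(v,Jw)$ makes $\nabla_uJ$ self-adjoint. -/
theorem tensorF_symm (hd : DifferentiableAt ℝ h p) (hJd : DifferentiableAt ℝ J p)
    (hs : ∀ᶠ q in 𝓝 p, ∀ v w, h q v w = h q w v)
    (hJ : ∀ᶠ q in 𝓝 p, ∀ v w, h q (J q v) w = h q v (J q w)) (hp : (h p).IsInvertible)
    (u v w : V) : tensorF h J p u v w = tensorF h J p u w v := by
  have h1 := two_mul_tensorF hp hJ.self_of_nhds u v w
  have h2 := two_mul_tensorF hp hJ.self_of_nhds u w v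
  have h3 := fderiv_anti_symm hd hJd hJ u v w
  have S := fderiv_bilin_symm hd hs
  have h4 := hs.self_of_nhds (fderiv ℝ J p u w) v
  rw [koszul_apply, koszul_apply] at h1 h2
  linarith [S u (J p w) v, S v u (J p w), S (J p v) u w, S w u (J p v), S (J p w) u v,
    S v (J p w) u, S w (J p v) u, S u (J p v) w]

theorem tensorF_diag (hd : DifferentiableAt ℝ h p)
    (hs : ∀ᶠ q in 𝓝 p, ∀ v w, h q v w = h q w v)
    (hJ : ∀ v w, h p (J p v) w = h p v (J p w)) (hp : (h p).IsInvertible) (u : V) :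
    tensorF h J p u u u =
      fderiv ℝ h p (J p u) u u + h p (fderiv ℝ J p u u) u - fderiv ℝ h p u (J p u) u := by
  have h1 := two_mul_tensorF hp hJ u u u
  have S := fderiv_bilin_symm hd hs
  rw [koszul_apply, koszul_apply, S u u (J p u)] at h1
  linarith

/-- By `tensorF_symm` the cyclic sum is a totally symmetric trilinear form; the proof is the
polarization identity on sums of subsets of `u`, `v`, `w`. -/
theorem cyclic_sum_eq_zero_iff (hd : DifferentiableAt ℝ h p) (hJd : DifferentiableAt ℝ J p)
    (hs : ∀ᶠ q in 𝓝 p, ∀ v w, h q v w = h q w v)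
    (hJ : ∀ᶠ q in 𝓝 p, ∀ v w, h q (J q v) w = h q v (J q w)) (hp : (h p).IsInvertible) :
    (∀ u v w, tensorF h J p u v w + tensorF h J p v w u + tensorF h J p w u v = 0) ↔
      ∀ u, tensorF h J p u u u = 0 := by
  constructor
  · intro H u
    have := H u u u
    linarith
  · intro H u v w
    have e1 := H (u + v + w)
    have e2 := H (u + v)
    have e3 := H (v + w)
    have e4 := H (u + w)
    have e5 := H u
    have e6 := H v
    have e7 := H w
    have A1 : ∀ a b c d, tensorF h J p (a + b) c d = tensorF h J p a c d + tensorF h J p b c d := by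
      intro a b c d
      simp only [tensorF, nablaEndo, map_add, map_sub, add_apply, sub_apply]; ring
    have A2 : ∀ a b c d, tensorF h J p c (a + b) d = tensorF h J p c a d + tensorF h J p c b d := by
      intro a b c d
      simp only [tensorF, nablaEndo, map_add, map_sub, add_apply, sub_apply]; ring
    have A3 : ∀ a b c d, tensorF h J p c d (a + b) = tensorF h J p c d a + tensorF h J p c d b := by
      intro a b c d
      simp only [tensorF, map_add]
    have S := tensorF_symm hd hJd hs hJ hp
    simp only [A1, A2, A3] at e1 e2 e3 e4
    have s1 := S u v w
    have s2 := S v w u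
    have s3 := S w u v
    linarith

end CyclicSum

end NaturalLift
namespace NaturalLift

/-! ### Riemannian coefficient fields near a point. -/

section Base

variable {E : Type*} [NormedAddCommGroup E] [NormedSpace ℝ E]

/-- The coefficient field `g` is a Riemannian metric of class `C²` near `x`. -/
structure IsRiemannianNear (g : E → E →L[ℝ] E →L[ℝ] ℝ) (x : E) : Prop where
  contDiffAt : ContDiffAt ℝ 2 g x
  symm : ∀ᶠ q in 𝓝 x, ∀ v w, g q v w = g q w v
  pos : ∀ᶠ q in 𝓝 x, ∀ v, v ≠ 0 → 0 < g q v v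

theorem isInvertible_of_injective {V : Type*} [NormedAddCommGroup V] [NormedSpace ℝ V]
    [FiniteDimensional ℝ V] {b : V →L[ℝ] V →L[ℝ] ℝ} (hb : ∀ v, (∀ w, b v w = 0) → v = 0) :
    b.IsInvertible := by
  have hinj : Function.Injective (b : V →ₗ[ℝ] V →L[ℝ] ℝ) := by
    rw [← LinearMap.ker_eq_bot, LinearMap.ker_eq_bot']
    intro v hv
    apply hb
    intro w
    have := congrArg (fun f : V →L[ℝ] ℝ => f w) hv
    simpa using this
  have hfin : Module.finrank ℝ V = Module.finrank ℝ (V →L[ℝ] ℝ) := by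
    rw [← (LinearMap.toContinuousLinearMap : (V →ₗ[ℝ] ℝ) ≃ₗ[ℝ] V →L[ℝ] ℝ).finrank_eq]
    exact (Subspace.dual_finrank_eq (K := ℝ) (V := V)).symm
  refine ⟨(LinearEquiv.ofInjectiveOfFinrankEq (b : V →ₗ[ℝ] V →L[ℝ] ℝ) hinj
    hfin).toContinuousLinearEquiv, ?_⟩
  ext v w
  rfl

theorem differentiableAt_of_apply {V W X : Type*} [NormedAddCommGroup V] [NormedSpace ℝ V]
    [FiniteDimensional ℝ V] [NormedAddCommGroup W] [NormedSpace ℝ W]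
    [NormedAddCommGroup X] [NormedSpace ℝ X] {f : X → V →L[ℝ] W} {p : X}
    (hf : ∀ v, DifferentiableAt ℝ (fun q => f q v) p) : DifferentiableAt ℝ f p := by
  let b := Module.finBasis ℝ V
  have : f = fun q => ∑ i, (b.coord i).toContinuousLinearMap.smulRight (f q (b i)) := by
    ext q v
    have h : f q v = f q (∑ i, b.repr v i • b i) := by rw [b.sum_repr]
    rw [h, map_sum]
    simp
  rw [this]
  refine DifferentiableAt.fun_sum fun i _ => ?_
  exact ((ContinuousLinearMap.smulRightL ℝ V W
    (b.coord i).toContinuousLinearMap).differentiableAt).comp p (hf (b i))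

variable {g : E → E →L[ℝ] E →L[ℝ] ℝ} {x : E}

namespace IsRiemannianNear

theorem differentiableAt (hg : IsRiemannianNear g x) : DifferentiableAt ℝ g x :=
  hg.contDiffAt.differentiableAt (by norm_num)

theorem eq_zero (hg : IsRiemannianNear g x) {v : E} (hv : ∀ w, g x v w = 0) : v = 0 := by
  by_contra h
  exact (hg.pos.self_of_nhds v h).ne' (hv v)

theorem nonneg (hg : IsRiemannianNear g x) (v : E) : 0 ≤ g x v v := by
  by_cases h : v = 0
  · simp [h]
  · exact (hg.pos.self_of_nhds v h).le

theorem eventually (hg : IsRiemannianNear g x) : ∀ᶠ q in 𝓝 x, IsRiemannianNear g q := by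
  filter_upwards [hg.contDiffAt.eventually (by simp), eventually_eventually_nhds.2 hg.symm,
    eventually_eventually_nhds.2 hg.pos] with q h1 h2 h3 using ⟨h1, h2, h3⟩

theorem christoffel_symm (hg : IsRiemannianNear g x) (u v : E) :
    christoffel g x u v = christoffel g x v u :=
  NaturalLift.christoffel_symm hg.differentiableAt hg.symm u v

theorem isInvertible [FiniteDimensional ℝ E] (hg : IsRiemannianNear g x) : (g x).IsInvertible :=
  isInvertible_of_injective fun _ hv => hg.eq_zero hv

variable [FiniteDimensional ℝ E]

theorem differentiableAt_christoffel (hg : IsRiemannianNear g x) :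
    DifferentiableAt ℝ (christoffel g) x :=
  haveI := FiniteDimensional.complete ℝ E
  NaturalLift.differentiableAt_christoffel hg.contDiffAt hg.isInvertible

theorem fderiv_eq (hg : IsRiemannianNear g x) (u v w : E) :
    fderiv ℝ g x u v w = g x (christoffel g x u v) w + g x v (christoffel g x u w) :=
  fderiv_eq_christoffel hg.differentiableAt hg.symm hg.isInvertible u v w

theorem curvature_skew (hg : IsRiemannianNear g x) (u v w : E) :
    g x (curvature g x u v w) w = 0 :=
  curvature_skew_right hg.contDiffAt hg.symm (hg.eventually.mono fun _ h => h.isInvertible)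
    hg.differentiableAt_christoffel u v w

theorem curvature_eq (hg : IsRiemannianNear g x) {c : ℝ}
    (hc : ∀ u v, g x (curvature g x u v v) u = c * (g x u u * g x v v - g x u v ^ 2))
    (u v w : E) : curvature g x u v w = c • (g x v w • u - g x u w • v) :=
  curvature_eq_of_sectional hg.symm.self_of_nhds (fun _ hv => hg.eq_zero hv)
    (curvature_bianchi (hg.eventually.mono fun _ h => h.christoffel_symm)
      hg.differentiableAt_christoffel) hg.curvature_skew hc u v w

end IsRiemannianNear

end Base

/-! ### Derivatives of the building blocks along lines of the tangent bundle. -/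

section Derivatives

variable {E : Type*} [NormedAddCommGroup E] [NormedSpace ℝ E]

theorem form_apply (g : E → E →L[ℝ] E →L[ℝ] ℝ) (p : E × E) (c d : ℝ) (a b : E) :
    form g p c d a b = c * g p.1 a b + d * (g p.1 p.2 a * g p.1 p.2 b) := by
  simp [form]

theorem endo_apply (g : E → E →L[ℝ] E →L[ℝ] ℝ) (p : E × E) (a b : ℝ) (v : E) :
    endo g p a b v = a • v + (b * g p.1 p.2 v) • p.2 := by
  simp [endo, mul_smul]

theorem vpart_apply (g : E → E →L[ℝ] E →L[ℝ] ℝ) (p ξ : E × E) :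
    vpart g p ξ = ξ.2 + christoffel g p.1 p.2 ξ.1 := rfl

theorem hpart_apply (ξ : E × E) : hpart ξ = ξ.1 := rfl

theorem hlift_apply (g : E → E →L[ℝ] E →L[ℝ] ℝ) (p : E × E) (v : E) :
    hlift g p v = (v, -christoffel g p.1 p.2 v) := rfl

theorem vlift_apply (v : E) : vlift v = (0, v) := rfl

@[simp] theorem hpart_hlift (g : E → E →L[ℝ] E →L[ℝ] ℝ) (p : E × E) (v : E) :
    hpart (hlift g p v) = v := rfl

@[simp] theorem hpart_vlift (v : E) : hpart (vlift v) = 0 := rfl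

@[simp] theorem vpart_hlift (g : E → E →L[ℝ] E →L[ℝ] ℝ) (p : E × E) (v : E) :
    vpart g p (hlift g p v) = 0 := by
  simp [vpart_apply, hlift_apply]

@[simp] theorem vpart_vlift (g : E → E →L[ℝ] E →L[ℝ] ℝ) (p : E × E) (v : E) :
    vpart g p (vlift v) = v := by
  simp [vpart_apply, vlift_apply]

/-- The derivative of `form g p (c t) (d t) a b` when `y = p.2` moves in the direction `B`. -/
noncomputable def dform (g : E → E →L[ℝ] E →L[ℝ] ℝ) (p : E × E) (d c' d' : ℝ) (B a b : E) : ℝ :=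
  c' * g p.1 p.2 B * g p.1 a b + d' * g p.1 p.2 B * (g p.1 p.2 a * g p.1 p.2 b)
    + d * (g p.1 B a * g p.1 p.2 b + g p.1 p.2 a * g p.1 B b)

/-- The derivative of `endo g p (a t) (b t) v` when `y = p.2` moves in the direction `B`. -/
noncomputable def dendo (g : E → E →L[ℝ] E →L[ℝ] ℝ) (p : E × E) (b a' b' : ℝ) (B v : E) : E :=
  (a' * g p.1 p.2 B) • v + (b' * g p.1 p.2 B * g p.1 p.2 v) • p.2
    + b • (g p.1 B v • p.2 + g p.1 p.2 v • B)

/-- The vertical part of the covariant derivative, along `η` and with respect to the connection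
induced on the tangent bundle by the horizontal distribution, of a constant field `ξ`. -/
noncomputable def connV (g : E → E →L[ℝ] E →L[ℝ] ℝ) (p η ξ : E × E) : E :=
  fderiv ℝ (christoffel g) p.1 η.1 p.2 ξ.1 + christoffel g p.1 η.2 ξ.1
    + christoffel g p.1 η.1 (vpart g p ξ)

/-- The covariant derivative, along `η` and with respect to the connection induced on the tangent
bundle by the horizontal distribution, of a constant field `ξ`. -/
noncomputable def conn (g : E → E →L[ℝ] E →L[ℝ] ℝ) (p η ξ : E × E) : E × E :=
  hlift g p (christoffel g p.1 η.1 ξ.1) + vlift (connV g p η ξ)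

theorem hasDerivAt_line (p η : E × E) : HasDerivAt (fun s : ℝ => p + s • η) η 0 := by
  simpa using ((hasDerivAt_id (0 : ℝ)).smul_const η).const_add p

theorem hasDerivAt_line_fst (p η : E × E) :
    HasDerivAt (fun s : ℝ => (p + s • η).1) η.1 0 := by
  simpa using ((hasDerivAt_id (0 : ℝ)).smul_const η.1).const_add p.1

theorem hasDerivAt_line_snd (p η : E × E) :
    HasDerivAt (fun s : ℝ => (p + s • η).2) η.2 0 := by
  simpa using ((hasDerivAt_id (0 : ℝ)).smul_const η.2).const_add p.2

variable {g : E → E →L[ℝ] E →L[ℝ] ℝ} {p : E × E}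

theorem vpart_eq (hg : IsRiemannianNear g p.1) (η : E × E) :
    vpart g p η = η.2 + christoffel g p.1 η.1 p.2 := by
  rw [vpart_apply, hg.christoffel_symm]

theorem energy_nonneg (hg : IsRiemannianNear g p.1) : 0 ≤ energy g p :=
  div_nonneg (hg.nonneg _) (by norm_num)

theorem eventually_energy_nonneg (hg : IsRiemannianNear g p.1) :
    ∀ᶠ q in 𝓝 p, 0 ≤ energy g q := by
  filter_upwards [continuous_fst.continuousAt.eventually hg.eventually] with q hq
    using energy_nonneg hq

theorem hasDerivWithinAt_ddt {k : ℝ → ℝ} (hk : ContDiffOn ℝ ∞ k (Set.Ici 0)) {t : ℝ} (ht : 0 ≤ t) :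
    HasDerivWithinAt k (ddt k t) (Set.Ici 0) t :=
  (hk.differentiableOn (by simp) t ht).hasDerivWithinAt

variable [FiniteDimensional ℝ E]

/-- The product rule for a parallel metric: $a'+\Gamma(\eta_1,a)$ is the covariant derivative of `a`
along the projected line. -/
theorem hasDerivAt_metric (hg : IsRiemannianNear g p.1) (η : E × E) {a b : ℝ → E} {a' b' : E}
    (ha : HasDerivAt a a' 0) (hb : HasDerivAt b b' 0) :
    HasDerivAt (fun s : ℝ => g (p + s • η).1 (a s) (b s))
      (g p.1 (a' + christoffel g p.1 η.1 (a 0)) (b 0)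
        + g p.1 (a 0) (b' + christoffel g p.1 η.1 (b 0))) 0 := by
  have h0 : HasFDerivAt g (fderiv ℝ g p.1) ((p + (0 : ℝ) • η).1) := by
    simpa using hg.differentiableAt.hasFDerivAt
  have h1 : HasDerivAt (fun s : ℝ => g (p + s • η).1) (fderiv ℝ g p.1 η.1) 0 :=
    h0.comp_hasDerivAt (0 : ℝ) (hasDerivAt_line_fst p η)
  refine ((h1.clm_apply ha).clm_apply hb).congr_deriv ?_
  simp only [map_add, add_apply, zero_smul, add_zero, hg.fderiv_eq]
  ring

theorem hasDerivAt_christoffel (hg : IsRiemannianNear g p.1) (η : E × E) {a b : ℝ → E} {a' b' : E}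
    (ha : HasDerivAt a a' 0) (hb : HasDerivAt b b' 0) :
    HasDerivAt (fun s : ℝ => christoffel g (p + s • η).1 (a s) (b s))
      (fderiv ℝ (christoffel g) p.1 η.1 (a 0) (b 0) + christoffel g p.1 a' (b 0)
        + christoffel g p.1 (a 0) b') 0 := by
  have h0 : HasFDerivAt (christoffel g) (fderiv ℝ (christoffel g) p.1) ((p + (0 : ℝ) • η).1) := by
    simpa using hg.differentiableAt_christoffel.hasFDerivAt
  have h1 : HasDerivAt (fun s : ℝ => christoffel g (p + s • η).1)
      (fderiv ℝ (christoffel g) p.1 η.1) 0 :=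
    HasFDerivAt.comp_hasDerivAt (f := fun s : ℝ => (p + s • η).1) (0 : ℝ) h0
      (hasDerivAt_line_fst p η)
  refine ((h1.clm_apply ha).clm_apply hb).congr_deriv ?_
  simp only [add_apply, zero_smul, add_zero]

/-- The covariant derivative of the tautological field $y$ along `η` is the vertical part of `η`. -/
theorem hasDerivAt_metric_snd (hg : IsRiemannianNear g p.1) (η : E × E) {a : ℝ → E} {a' : E}
    (ha : HasDerivAt a a' 0) :
    HasDerivAt (fun s : ℝ => g (p + s • η).1 (p + s • η).2 (a s))
      (g p.1 (vpart g p η) (a 0) + g p.1 p.2 (a' + christoffel g p.1 η.1 (a 0))) 0 := by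
  have := hasDerivAt_metric hg η (hasDerivAt_line_snd p η) ha
  simpa only [zero_smul, add_zero, ← vpart_eq hg] using this

theorem hasDerivAt_energy (hg : IsRiemannianNear g p.1) (η : E × E) :
    HasDerivAt (fun s : ℝ => energy g (p + s • η)) (g p.1 p.2 (vpart g p η)) 0 := by
  have := (hasDerivAt_metric_snd hg η (hasDerivAt_line_snd p η)).div_const 2
  refine this.congr_deriv ?_
  simp only [zero_smul, add_zero, ← vpart_eq hg]
  rw [hg.symm.self_of_nhds (vpart g p η)]
  ring

/-- The coefficient is controlled only on $[0,\infty)$, but the energy stays nonnegative near `p`;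
the one-sided derivative thus suffices for a two-sided one along the line, even at $y=0$. -/
theorem hasDerivAt_coeff (hg : IsRiemannianNear g p.1) (η : E × E) {k : ℝ → ℝ}
    (hk : ContDiffOn ℝ ∞ k (Set.Ici 0)) :
    HasDerivAt (fun s : ℝ => k (energy g (p + s • η)))
      (ddt k (energy g p) * g p.1 p.2 (vpart g p η)) 0 := by
  have hev : ∀ᶠ s : ℝ in 𝓝 0, 0 ≤ energy g (p + s • η) := by
    have hc : Filter.Tendsto (fun s : ℝ => p + s • η) (𝓝 0) (𝓝 p) := by
      have := (hasDerivAt_line p η).continuousAt.tendsto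
      simpa using this
    exact hc.eventually (eventually_energy_nonneg hg)
  have h1 : HasDerivWithinAt k (ddt k (energy g p)) (Set.Ici 0) (energy g (p + (0 : ℝ) • η)) := by
    simpa using hasDerivWithinAt_ddt hk (energy_nonneg hg)
  have h2 := HasDerivWithinAt.comp (0 : ℝ) (h := fun s : ℝ => energy g (p + s • η)) h1
    ((hasDerivAt_energy hg η).hasDerivWithinAt (s := {s | 0 ≤ energy g (p + s • η)}))
    (fun s hs => hs)
  exact h2.hasDerivAt hev

theorem hasDerivAt_form (hg : IsRiemannianNear g p.1) (η : E × E) {c d : ℝ → ℝ}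
    (hc : ContDiffOn ℝ ∞ c (Set.Ici 0)) (hd : ContDiffOn ℝ ∞ d (Set.Ici 0))
    {a b : ℝ → E} {a' b' : E} (ha : HasDerivAt a a' 0) (hb : HasDerivAt b b' 0) :
    HasDerivAt (fun s : ℝ => form g (p + s • η) (c (energy g (p + s • η))) (d (energy g (p + s • η)))
        (a s) (b s))
      (dform g p (d (energy g p)) (ddt c (energy g p)) (ddt d (energy g p)) (vpart g p η) (a 0) (b 0)
        + form g p (c (energy g p)) (d (energy g p)) (a' + christoffel g p.1 η.1 (a 0)) (b 0)
        + form g p (c (energy g p)) (d (energy g p)) (a 0) (b' + christoffel g p.1 η.1 (b 0)))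
      0 := by
  simp only [form_apply]
  have := ((hasDerivAt_coeff hg η hc).mul (hasDerivAt_metric hg η ha hb)).add
    ((hasDerivAt_coeff hg η hd).mul
      ((hasDerivAt_metric_snd hg η ha).mul (hasDerivAt_metric_snd hg η hb)))
  refine this.congr_deriv ?_
  simp only [zero_smul, add_zero, dform, Pi.mul_apply]
  ring

/-- The first two terms form the covariant derivative of the result; the last Christoffel term
converts it to an ordinary derivative. -/
theorem hasDerivAt_endo (hg : IsRiemannianNear g p.1) (η : E × E) {k l : ℝ → ℝ}
    (hk : ContDiffOn ℝ ∞ k (Set.Ici 0)) (hl : ContDiffOn ℝ ∞ l (Set.Ici 0))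
    {a : ℝ → E} {a' : E} (ha : HasDerivAt a a' 0) :
    HasDerivAt (fun s : ℝ => endo g (p + s • η) (k (energy g (p + s • η))) (l (energy g (p + s • η)))
        (a s))
      (dendo g p (l (energy g p)) (ddt k (energy g p)) (ddt l (energy g p)) (vpart g p η) (a 0)
        + endo g p (k (energy g p)) (l (energy g p)) (a' + christoffel g p.1 η.1 (a 0))
        - christoffel g p.1 η.1 (endo g p (k (energy g p)) (l (energy g p)) (a 0)))
      0 := by
  simp only [endo_apply]
  have := ((hasDerivAt_coeff hg η hk).smul ha).add
    (((hasDerivAt_coeff hg η hl).mul (hasDerivAt_metric_snd hg η ha)).smul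
      (hasDerivAt_line_snd p η))
  refine this.congr_deriv ?_
  simp only [zero_smul, add_zero, dendo, Pi.mul_apply, map_add, map_smul]
  rw [vpart_eq hg]
  simp only [map_add, add_apply]
  module

theorem hasDerivAt_vpart (hg : IsRiemannianNear g p.1) (η ξ : E × E) :
    HasDerivAt (fun s : ℝ => vpart g (p + s • η) ξ)
      (connV g p η ξ - christoffel g p.1 η.1 (vpart g p ξ)) 0 := by
  simp only [vpart_apply]
  have := (hasDerivAt_christoffel hg η (hasDerivAt_line_snd p η)
    (hasDerivAt_const (0 : ℝ) ξ.1)).const_add ξ.2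
  refine this.congr_deriv ?_
  simp [connV, vpart_apply]

end Derivatives

end NaturalLift
namespace NaturalLift

/-! ### Derivatives of `liftG` and `liftJ` through the connection `conn`. -/

section LiftDerivatives

variable {E : Type*} [NormedAddCommGroup E] [NormedSpace ℝ E]

theorem liftG_apply (K : Coeffs) (g : E → E →L[ℝ] E →L[ℝ] ℝ) (p ξ η : E × E) :
    liftG K g p ξ η =
      form g p (K.c1 (energy g p)) (K.d1 (energy g p)) (hpart ξ) (hpart η)
      + form g p (K.c2 (energy g p)) (K.d2 (energy g p)) (vpart g p ξ) (vpart g p η)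
      + form g p (K.c3 (energy g p)) (K.d3 (energy g p)) (vpart g p ξ) (hpart η)
      + form g p (K.c3 (energy g p)) (K.d3 (energy g p)) (hpart ξ) (vpart g p η) := rfl

theorem liftJ_apply (K : Coeffs) (g : E → E →L[ℝ] E →L[ℝ] ℝ) (p ξ : E × E) :
    liftJ K g p ξ =
      vlift (endo g p (K.a1 (energy g p)) (K.b1 (energy g p)) (hpart ξ)
          + endo g p (K.a3 (energy g p)) (K.b3 (energy g p)) (vpart g p ξ))
        + hlift g p (endo g p (K.a4 (energy g p)) (K.b4 (energy g p)) (hpart ξ)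
          - endo g p (K.a2 (energy g p)) (K.b2 (energy g p)) (vpart g p ξ)) := by
  simp only [map_add, map_sub, liftJ, add_apply, sub_apply, ContinuousLinearMap.comp_apply]
  abel

/-- The derivative of the coefficients of `liftG K g p` when `y = p.2` moves in the direction
`B`. -/
noncomputable def dG (K : Coeffs) (g : E → E →L[ℝ] E →L[ℝ] ℝ) (p : E × E) (B : E) (ξ η : E × E) :
    ℝ :=
  let t := energy g p
  dform g p (K.d1 t) (ddt K.c1 t) (ddt K.d1 t) B (hpart ξ) (hpart η)
    + dform g p (K.d2 t) (ddt K.c2 t) (ddt K.d2 t) B (vpart g p ξ) (vpart g p η)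
    + dform g p (K.d3 t) (ddt K.c3 t) (ddt K.d3 t) B (vpart g p ξ) (hpart η)
    + dform g p (K.d3 t) (ddt K.c3 t) (ddt K.d3 t) B (hpart ξ) (vpart g p η)

/-- The derivative of the coefficients of `liftJ K g p` when `y = p.2` moves in the direction
`B`. -/
noncomputable def dJ (K : Coeffs) (g : E → E →L[ℝ] E →L[ℝ] ℝ) (p : E × E) (B : E) (ξ : E × E) :
    E × E :=
  let t := energy g p
  vlift (dendo g p (K.b1 t) (ddt K.a1 t) (ddt K.b1 t) B (hpart ξ)
      + dendo g p (K.b3 t) (ddt K.a3 t) (ddt K.b3 t) B (vpart g p ξ))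
    + hlift g p (dendo g p (K.b4 t) (ddt K.a4 t) (ddt K.b4 t) B (hpart ξ)
      - dendo g p (K.b2 t) (ddt K.a2 t) (ddt K.b2 t) B (vpart g p ξ))

theorem conn_neg (g : E → E →L[ℝ] E →L[ℝ] ℝ) (p η ξ : E × E) :
    conn g p η (-ξ) = -conn g p η ξ := by
  simp only [conn, connV, map_neg, Prod.fst_neg, map_add]
  abel

variable {g : E → E →L[ℝ] E →L[ℝ] ℝ} {p : E × E} {K : Coeffs}

theorem liftG_symm (hs : ∀ v w, g p.1 v w = g p.1 w v) (ξ η : E × E) :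
    liftG K g p ξ η = liftG K g p η ξ := by
  simp only [liftG_apply, form_apply]
  rw [hs (hpart ξ), hs (vpart g p ξ) (vpart g p η), hs (vpart g p ξ) (hpart η),
    hs (hpart ξ) (vpart g p η)]
  ring

theorem differentiableAt_coeff (hg : IsRiemannianNear g p.1) {k : ℝ → ℝ}
    (hk : ContDiffOn ℝ ∞ k (Set.Ici 0)) : DifferentiableAt ℝ (fun q => k (energy g q)) p := by
  have h0 : DifferentiableAt ℝ (fun q : E × E => g q.1) p :=
    hg.differentiableAt.comp p differentiableAt_fst
  have h1 : DifferentiableAt ℝ (energy g) p := by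
    change DifferentiableAt ℝ (fun q : E × E => g q.1 q.2 q.2 / 2) p
    simp only [div_eq_mul_inv]
    exact ((h0.clm_apply differentiableAt_snd).clm_apply differentiableAt_snd).mul_const (2 : ℝ)⁻¹
  have h2 := (hasDerivWithinAt_ddt hk (energy_nonneg hg)).differentiableWithinAt
  have h3 : DifferentiableWithinAt ℝ (k ∘ energy g) {q | 0 ≤ energy g q} p :=
    h2.comp p h1.differentiableWithinAt (fun q hq => hq)
  exact h3.differentiableAt (eventually_energy_nonneg hg)

theorem differentiableAt_form (hg : IsRiemannianNear g p.1) {c d : ℝ → ℝ}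
    (hc : ContDiffOn ℝ ∞ c (Set.Ici 0)) (hd : ContDiffOn ℝ ∞ d (Set.Ici 0)) {a b : E × E → E}
    (ha : DifferentiableAt ℝ a p) (hb : DifferentiableAt ℝ b p) :
    DifferentiableAt ℝ (fun q => form g q (c (energy g q)) (d (energy g q)) (a q) (b q)) p := by
  have h0 : DifferentiableAt ℝ (fun q : E × E => g q.1) p :=
    hg.differentiableAt.comp p differentiableAt_fst
  have h1 := h0.clm_apply differentiableAt_snd
  simp only [form_apply]
  exact ((differentiableAt_coeff hg hc).fun_mul ((h0.clm_apply ha).clm_apply hb)).fun_add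
    ((differentiableAt_coeff hg hd).fun_mul ((h1.clm_apply ha).fun_mul (h1.clm_apply hb)))

theorem differentiableAt_endo (hg : IsRiemannianNear g p.1) {k l : ℝ → ℝ}
    (hk : ContDiffOn ℝ ∞ k (Set.Ici 0)) (hl : ContDiffOn ℝ ∞ l (Set.Ici 0)) {a : E × E → E}
    (ha : DifferentiableAt ℝ a p) :
    DifferentiableAt ℝ (fun q => endo g q (k (energy g q)) (l (energy g q)) (a q)) p := by
  have h0 : DifferentiableAt ℝ (fun q : E × E => g q.1) p :=
    hg.differentiableAt.comp p differentiableAt_fst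
  simp only [endo_apply]
  exact ((differentiableAt_coeff hg hk).fun_smul ha).fun_add
    (((differentiableAt_coeff hg hl).fun_mul
      ((h0.clm_apply differentiableAt_snd).clm_apply ha)).fun_smul differentiableAt_snd)

variable [FiniteDimensional ℝ E]

/-- The torsion of `conn` is the curvature of the base. -/
theorem conn_sub_conn (hg : IsRiemannianNear g p.1) (η ξ : E × E) :
    conn g p η ξ - conn g p ξ η = vlift (curvature g p.1 η.1 ξ.1 p.2) := by
  have hΓ := hg.differentiableAt_christoffel
  have key : ∀ a b c, fderiv ℝ (christoffel g) p.1 a b c = fderiv ℝ (christoffel g) p.1 a c b := by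
    intro a b c
    have : (fun q => christoffel g q b c) =ᶠ[𝓝 p.1] fun q => christoffel g q c b := by
      filter_upwards [hg.eventually] with q hq using hq.christoffel_symm b c
    have := congrArg (fun L : E →L[ℝ] E => L a) this.fderiv_eq
    rw [(hasFDerivAt_bilin_apply hΓ b c).fderiv, (hasFDerivAt_bilin_apply hΓ c b).fderiv] at this
    simpa using this
  rw [conn, conn, hg.christoffel_symm ξ.1 η.1, add_sub_add_left_eq_sub, ← map_sub]
  congr 1
  simp only [connV, curvature, vpart_apply, map_add]
  rw [key η.1 p.2, key ξ.1 p.2, hg.christoffel_symm η.2 ξ.1, hg.christoffel_symm η.1 ξ.2,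
    hg.christoffel_symm p.2 ξ.1, hg.christoffel_symm p.2 η.1]
  abel

theorem hasDerivAt_liftG (hg : IsRiemannianNear g p.1) (hK : K.Smooth) (η ξ ζ : E × E) :
    HasDerivAt (fun s : ℝ => liftG K g (p + s • η) ξ ζ)
      (dG K g p (vpart g p η) ξ ζ + liftG K g p (conn g p η ξ) ζ
        + liftG K g p ξ (conn g p η ζ)) 0 := by
  simp only [liftG_apply]
  have h (v : E × E) := hasDerivAt_const (0 : ℝ) (hpart v)
  have h' (v : E × E) := hasDerivAt_vpart hg η v
  refine ((((hasDerivAt_form hg η hK.c1 hK.d1 (h ξ) (h ζ)).add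
    (hasDerivAt_form hg η hK.c2 hK.d2 (h' ξ) (h' ζ))).add
    (hasDerivAt_form hg η hK.c3 hK.d3 (h' ξ) (h ζ))).add
    (hasDerivAt_form hg η hK.c3 hK.d3 (h ξ) (h' ζ))).congr_deriv ?_
  simp only [zero_smul, add_zero, zero_add, sub_add_cancel, dG, conn, map_add, hpart_hlift,
    hpart_vlift, vpart_hlift, vpart_vlift]
  simp only [hpart_apply]
  ring

theorem hasDerivAt_liftJ (hg : IsRiemannianNear g p.1) (hK : K.Smooth) (η ξ : E × E) :
    HasDerivAt (fun s : ℝ => liftJ K g (p + s • η) ξ)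
      (dJ K g p (vpart g p η) ξ + liftJ K g p (conn g p η ξ) - conn g p η (liftJ K g p ξ)) 0 := by
  have h := hasDerivAt_const (0 : ℝ) (hpart ξ)
  have h' := hasDerivAt_vpart hg η ξ
  -- With $P$ and $Q$ the horizontal and vertical parts of $J\xi$, the chart components of $J\xi$
  -- are $(P,\,Q-\Gamma(y,P))$.
  have hQ := (hasDerivAt_endo hg η hK.a1 hK.b1 h).add (hasDerivAt_endo hg η hK.a3 hK.b3 h')
  have hP := (hasDerivAt_endo hg η hK.a4 hK.b4 h).sub (hasDerivAt_endo hg η hK.a2 hK.b2 h')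
  have hΓ := hasDerivAt_christoffel hg η (hasDerivAt_line_snd p η) hP
  refine ((hP.prodMk (hQ.sub hΓ)).congr_of_eventuallyEq
    (.of_forall fun s => ?_)).congr_deriv ?_
  · refine Prod.ext ?_ ?_
    · simp only [liftJ_apply, vlift_apply, hlift_apply, Prod.fst_add, zero_add, Pi.sub_apply]
    · simp only [liftJ_apply, vlift_apply, hlift_apply, Prod.snd_add, Pi.sub_apply, Pi.add_apply,
        sub_eq_add_neg]
  · simp only [zero_smul, add_zero, zero_add, sub_add_cancel, Pi.sub_apply]
    have e1 : hpart (conn g p η ξ) = christoffel g p.1 η.1 ξ.1 := by simp [conn]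
    have e2 : vpart g p (conn g p η ξ) = connV g p η ξ := by simp [conn]
    rw [liftJ_apply K g p (conn g p η ξ), e1, e2, hpart_apply]
    have e3 : vpart g p (liftJ K g p ξ) = endo g p (K.a1 (energy g p)) (K.b1 (energy g p)) ξ.1
        + endo g p (K.a3 (energy g p)) (K.b3 (energy g p)) (vpart g p ξ) := by
      simp [liftJ_apply, hpart_apply]
    have e4 : (liftJ K g p ξ).1 = endo g p (K.a4 (energy g p)) (K.b4 (energy g p)) ξ.1
        - endo g p (K.a2 (energy g p)) (K.b2 (energy g p)) (vpart g p ξ) := by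
      simp [liftJ_apply, hpart_apply, vlift_apply, hlift_apply]
    have e5 := connV.eq_1 g p η (liftJ K g p ξ)
    rw [e3, e4] at e5
    rw [conn, e5, e4]
    refine Prod.ext ?_ ?_
    · simp only [dJ, vlift_apply, hlift_apply, Prod.fst_add, Prod.fst_sub, zero_add, add_zero,
        hpart_apply, map_sub]
      abel
    · simp only [dJ, vlift_apply, hlift_apply, Prod.snd_add, Prod.snd_sub, hpart_apply, map_sub,
        map_add]
      abel

theorem differentiableAt_christoffel_apply (hg : IsRiemannianNear g p.1) {a : E × E → E}
    (ha : DifferentiableAt ℝ a p) :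
    DifferentiableAt ℝ (fun q : E × E => christoffel g q.1 q.2 (a q)) p := by
  have h1 : DifferentiableAt ℝ (fun q : E × E => christoffel g q.1) p :=
    hg.differentiableAt_christoffel.comp p differentiableAt_fst
  exact (h1.clm_apply differentiableAt_snd).clm_apply ha

theorem differentiableAt_vpart (hg : IsRiemannianNear g p.1) (ξ : E × E) :
    DifferentiableAt ℝ (fun q : E × E => vpart g q ξ) p :=
  (differentiableAt_const _).fun_add
    (differentiableAt_christoffel_apply hg (differentiableAt_const _))

theorem differentiableAt_liftG (hg : IsRiemannianNear g p.1) (hK : K.Smooth) :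
    DifferentiableAt ℝ (liftG K g) p := by
  refine differentiableAt_of_apply fun ξ => differentiableAt_of_apply fun η => ?_
  simp only [liftG_apply]
  have h (v : E × E) : DifferentiableAt ℝ (fun _ : E × E => hpart v) p := differentiableAt_const _
  have h' (v : E × E) := differentiableAt_vpart hg v
  exact (((differentiableAt_form hg hK.c1 hK.d1 (h ξ) (h η)).fun_add
    (differentiableAt_form hg hK.c2 hK.d2 (h' ξ) (h' η))).fun_add
    (differentiableAt_form hg hK.c3 hK.d3 (h' ξ) (h η))).fun_add
    (differentiableAt_form hg hK.c3 hK.d3 (h ξ) (h' η))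

theorem differentiableAt_liftJ (hg : IsRiemannianNear g p.1) (hK : K.Smooth) :
    DifferentiableAt ℝ (liftJ K g) p := by
  refine differentiableAt_of_apply fun ξ => ?_
  simp only [liftJ_apply]
  have h : DifferentiableAt ℝ (fun _ : E × E => hpart ξ) p := differentiableAt_const _
  have h' := differentiableAt_vpart hg ξ
  have hQ := (differentiableAt_endo hg hK.a1 hK.b1 h).fun_add
    (differentiableAt_endo hg hK.a3 hK.b3 h')
  have hP := (differentiableAt_endo hg hK.a4 hK.b4 h).fun_sub
    (differentiableAt_endo hg hK.a2 hK.b2 h')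
  have h0 : DifferentiableAt ℝ (fun _ : E × E => (0 : E)) p := differentiableAt_const _
  exact (h0.prodMk hQ).fun_add (hP.prodMk (differentiableAt_christoffel_apply hg hP).fun_neg)

theorem fderiv_apply_eq_of_line {V W : Type*} [NormedAddCommGroup V] [NormedSpace ℝ V]
    [NormedAddCommGroup W] [NormedSpace ℝ W] {f : V → W} {q η : V} {f' : W}
    (hf : DifferentiableAt ℝ f q) (h : HasDerivAt (fun s : ℝ => f (q + s • η)) f' 0) :
    fderiv ℝ f q η = f' := by
  have h1 : HasDerivAt (fun s : ℝ => q + s • η) η 0 := by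
    simpa using ((hasDerivAt_id (0 : ℝ)).smul_const η).const_add q
  have h2 : HasFDerivAt f (fderiv ℝ f q) (q + (0 : ℝ) • η) := by simpa using hf.hasFDerivAt
  exact (HasFDerivAt.comp_hasDerivAt (f := fun s : ℝ => q + s • η) 0 h2 h1).unique h

theorem fderiv_liftG (hg : IsRiemannianNear g p.1) (hK : K.Smooth) (η ξ ζ : E × E) :
    fderiv ℝ (liftG K g) p η ξ ζ =
      dG K g p (vpart g p η) ξ ζ + liftG K g p (conn g p η ξ) ζ
        + liftG K g p ξ (conn g p η ζ) := by
  have hd := differentiableAt_liftG hg hK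
  rw [fderiv_bilin_apply hd]
  exact fderiv_apply_eq_of_line (hasFDerivAt_bilin_apply hd ξ ζ).differentiableAt
    (hasDerivAt_liftG hg hK η ξ ζ)

theorem fderiv_liftJ (hg : IsRiemannianNear g p.1) (hK : K.Smooth) (η ξ : E × E) :
    fderiv ℝ (liftJ K g) p η ξ =
      dJ K g p (vpart g p η) ξ + liftJ K g p (conn g p η ξ) - conn g p η (liftJ K g p ξ) := by
  have hd := hasFDerivAt_apply_const (differentiableAt_liftJ hg hK).hasFDerivAt ξ
  rw [← fderiv_apply_eq_of_line hd.differentiableAt (hasDerivAt_liftJ hg hK η ξ), hd.fderiv]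
  rfl

end LiftDerivatives

end NaturalLift
namespace NaturalLift

/-! ### Consequences of the anti-Hermitian identities, and the diagonal of `tensorF`. -/

section AntiHermitian

variable {E : Type*} [NormedAddCommGroup E] [NormedSpace ℝ E]

/-- The natural lifts `liftG K g` and `liftJ K g` form an almost anti-Hermitian structure over a
neighbourhood of `x`. -/
structure IsAntiHermitianNear (K : Coeffs) (g : E → E →L[ℝ] E →L[ℝ] ℝ) (x : E) : Prop where
  sq_J : ∀ᶠ q in 𝓝 x, ∀ y ξ, liftJ K g (q, y) (liftJ K g (q, y) ξ) = -ξ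
  nondegenerate : ∀ y ξ, (∀ η, liftG K g (x, y) ξ η = 0) → ξ = 0
  anti : ∀ᶠ q in 𝓝 x, ∀ y ξ η,
    liftG K g (q, y) (liftJ K g (q, y) ξ) (liftJ K g (q, y) η) = -liftG K g (q, y) ξ η

variable {g : E → E →L[ℝ] E →L[ℝ] ℝ} {p : E × E} {K : Coeffs}

theorem dG_add_left (B : E) (ξ ξ' ζ : E × E) :
    dG K g p B (ξ + ξ') ζ = dG K g p B ξ ζ + dG K g p B ξ' ζ := by
  simp only [dG, dform, map_add, add_apply]
  ring

theorem dG_neg_left (B : E) (ξ ζ : E × E) : dG K g p B (-ξ) ζ = -dG K g p B ξ ζ := by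
  simp only [dG, dform, map_neg, neg_apply]
  ring

theorem dG_symm (hs : ∀ v w, g p.1 v w = g p.1 w v) (B : E) (ξ ζ : E × E) :
    dG K g p B ξ ζ = dG K g p B ζ ξ := by
  simp only [dG, dform]
  rw [hs (hpart ξ), hs (vpart g p ξ) (vpart g p ζ), hs (vpart g p ξ) (hpart ζ),
    hs (hpart ξ) (vpart g p ζ)]
  ring

theorem dJ_add (B : E) (ξ ζ : E × E) : dJ K g p B (ξ + ζ) = dJ K g p B ξ + dJ K g p B ζ := by
  simp only [dJ]
  have h : ∀ (b a' b' : ℝ) (v w : E), dendo g p b a' b' B (v + w) =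
      dendo g p b a' b' B v + dendo g p b a' b' B w := by
    intro b a' b' v w
    simp only [dendo, map_add]
    module
  rw [map_add hpart, map_add (vpart g p), h, h, h, h]
  simp only [map_add, map_sub]
  abel

namespace IsAntiHermitianNear

theorem eventually_sq (h : IsAntiHermitianNear K g p.1) :
    ∀ᶠ q in 𝓝 p, ∀ ξ, liftJ K g q (liftJ K g q ξ) = -ξ :=
  (continuous_fst.continuousAt.eventually h.sq_J).mono (by rintro ⟨q, y⟩ hq; exact hq y)

theorem eventually_anti (h : IsAntiHermitianNear K g p.1) :
    ∀ᶠ q in 𝓝 p, ∀ ξ η, liftG K g q (liftJ K g q ξ) (liftJ K g q η) = -liftG K g q ξ η :=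
  (continuous_fst.continuousAt.eventually h.anti).mono (by rintro ⟨q, y⟩ hq; exact hq y)

theorem eventually_adjoint (h : IsAntiHermitianNear K g p.1) :
    ∀ᶠ q in 𝓝 p, ∀ ξ η, liftG K g q (liftJ K g q ξ) η = liftG K g q ξ (liftJ K g q η) := by
  filter_upwards [h.eventually_sq, h.eventually_anti] with q h1 h2 ξ η
  have := h2 ξ (liftJ K g q η)
  rw [h1, map_neg] at this
  linarith

variable [FiniteDimensional ℝ E]

theorem isInvertible (h : IsAntiHermitianNear K g p.1) : (liftG K g p).IsInvertible :=
  isInvertible_of_injective fun ξ hξ => h.nondegenerate p.2 ξ hξ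

/-- The vertical derivative of $J^2=-1$: the `conn` terms cancel, since they act as a derivation. -/
theorem dJ_liftJ (h : IsAntiHermitianNear K g p.1) (hg : IsRiemannianNear g p.1) (hK : K.Smooth)
    (B : E) (ξ : E × E) : dJ K g p B (liftJ K g p ξ) = -liftJ K g p (dJ K g p B ξ) := by
  have key := fderiv_sq_eq_neg (differentiableAt_liftJ hg hK) h.eventually_sq (vlift B) ξ
  have hsq := h.eventually_sq.self_of_nhds
  rw [fderiv_liftJ hg hK, fderiv_liftJ hg hK, vpart_vlift, hsq, conn_neg, map_sub, map_add, hsq]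
    at key
  rw [eq_neg_iff_add_eq_zero, ← key]
  abel

theorem dG_liftJ (h : IsAntiHermitianNear K g p.1) (hg : IsRiemannianNear g p.1) (hK : K.Smooth)
    (B : E) (ξ ζ : E × E) : dG K g p B (liftJ K g p ξ) (liftJ K g p ζ) =
      -dG K g p B ξ ζ - liftG K g p (dJ K g p B ξ) (liftJ K g p ζ)
        - liftG K g p (liftJ K g p ξ) (dJ K g p B ζ) := by
  have key := fderiv_anti_eq_neg (differentiableAt_liftG hg hK) (differentiableAt_liftJ hg hK)
    h.eventually_anti (vlift B) ξ ζ
  have han := h.eventually_anti.self_of_nhds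
  simp only [fderiv_liftJ hg hK, fderiv_liftG hg hK, vpart_vlift, map_add,
    map_sub, add_apply, sub_apply, han] at key
  linarith

/-- In `tensorF_diag` the `conn` terms collect to $2G(D_{Ju}u-D_u(Ju),u)$, where now $D$ is `conn`;
by `conn_sub_conn` this is the curvature term. -/
theorem tensorF_diag_eq (h : IsAntiHermitianNear K g p.1) (hg : IsRiemannianNear g p.1)
    (hK : K.Smooth) (u : E × E) :
    tensorF (liftG K g) (liftJ K g) p u u u =
      dG K g p (vpart g p (liftJ K g p u)) u u + liftG K g p (dJ K g p (vpart g p u) u) u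
        - dG K g p (vpart g p u) (liftJ K g p u) u
        + 2 * liftG K g p (vlift (curvature g p.1 (hpart (liftJ K g p u)) (hpart u) p.2)) u := by
  have hs : ∀ᶠ q in 𝓝 p, ∀ v w, liftG K g q v w = liftG K g q w v := by
    filter_upwards [continuous_fst.continuousAt.eventually hg.symm] with q hq using liftG_symm hq
  have hadj := h.eventually_adjoint.self_of_nhds
  rw [tensorF_diag (differentiableAt_liftG hg hK) hs hadj h.isInvertible, fderiv_liftG hg hK,
    fderiv_liftJ hg hK, fderiv_liftG hg hK]
  simp only [hpart_apply]
  rw [← conn_sub_conn hg]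
  simp only [map_sub, map_add, sub_apply, add_apply, hadj]
  rw [hs.self_of_nhds u (conn g p (liftJ K g p u) u), hs.self_of_nhds u (liftJ K g p _), hadj]
  ring

theorem isQuasiAntiKahler_iff (h : IsAntiHermitianNear K g p.1) (hg : IsRiemannianNear g p.1)
    (hK : K.Smooth) :
    (∀ ξ η ζ : E × E, tensorF (liftG K g) (liftJ K g) p ξ η ζ
        + tensorF (liftG K g) (liftJ K g) p η ζ ξ + tensorF (liftG K g) (liftJ K g) p ζ ξ η = 0) ↔
      ∀ u, tensorF (liftG K g) (liftJ K g) p u u u = 0 := by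
  refine cyclic_sum_eq_zero_iff (differentiableAt_liftG hg hK) (differentiableAt_liftJ hg hK) ?_
    h.eventually_adjoint h.isInvertible
  filter_upwards [continuous_fst.continuousAt.eventually hg.symm] with q hq using liftG_symm hq

end IsAntiHermitianNear

end AntiHermitian

end NaturalLift
namespace NaturalLift

/-! ### Scalar coefficients occurring in the cubic form. -/

namespace Coeffs

variable (K : Coeffs) (t : ℝ)

/-- The algebraic relations between the coefficients of an almost anti-Hermitian structure that
are used to express everything in terms of `a1, a3, b1, b3, c1, c3, d1, d3`. -/
structure Compatible (K : Coeffs) : Prop where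
  a4_eq : ∀ t, 0 ≤ t → K.a4 t = -K.a3 t
  b4_eq : ∀ t, 0 ≤ t → K.b4 t = -K.b3 t
  a1_mul_a2 : ∀ t, 0 ≤ t → K.a1 t * K.a2 t = 1 + K.a3 t ^ 2
  c2_eq : ∀ t, 0 ≤ t → K.a1 t * K.c2 t - K.a3 t * K.c3 t = K.a3 t * K.c3 t - K.a2 t * K.c1 t
  a1_ne : ∀ t, 0 ≤ t → K.a1 t ≠ 0
  A1_ne : ∀ t, 0 ≤ t → K.a1 t + 2 * K.b1 t * t ≠ 0

/-- The eigenvalue `a₁ + 2 t b₁` of `endo a₁ b₁` on `y`. -/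
def A1 : ℝ := K.a1 t + 2 * K.b1 t * t

/-- The eigenvalue `a₃ + 2 t b₃` of `endo a₃ b₃` on `y`. -/
def A3 : ℝ := K.a3 t + 2 * K.b3 t * t

/-- First coefficient of the form `(X, Y) ↦ G(X^H, J Y^H) = e g(X, Y) + f g(X, y) g(Y, y)`. -/
def e : ℝ := K.a1 t * K.c3 t - K.a3 t * K.c1 t

/-- Second coefficient of the form `(X, Y) ↦ G(X^H, J Y^H) = e g(X, Y) + f g(X, y) g(Y, y)`. -/
def f : ℝ := K.A1 t * K.d3 t + K.b1 t * K.c3 t - K.A3 t * K.d1 t - K.b3 t * K.c1 t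

/-- The derivative of `Coeffs.e`. -/
noncomputable def de : ℝ := ddt K.a1 t * K.c3 t + K.a1 t * ddt K.c3 t - ddt K.a3 t * K.c1 t - K.a3 t * ddt K.c1 t

/-- The derivative of `Coeffs.f`. -/
noncomputable def df : ℝ := (ddt K.a1 t + 2 * ddt K.b1 t * t + 2 * K.b1 t) * K.d3 t + K.A1 t * ddt K.d3 t
  + ddt K.b1 t * K.c3 t + K.b1 t * ddt K.c3 t
  - (ddt K.a3 t + 2 * ddt K.b3 t * t + 2 * K.b3 t) * K.d1 t - K.A3 t * ddt K.d1 t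
  - ddt K.b3 t * K.c1 t - K.b3 t * ddt K.c1 t

/-- `G(v^V, J Y^H) = κ g(v, Y)` for `v` orthogonal to `y`. -/
def kap : ℝ := K.a1 t * K.c2 t - K.a3 t * K.c3 t

/-- The coefficient `μ` of `(∇_{αX} α) W - (∇_{αW} α) X = μ (g(X, y) W - g(W, y) X)`, where
`α = endo a₁ b₁`. -/
noncomputable def mu : ℝ := K.A1 t * ddt K.a1 t - K.a1 t * K.b1 t

/-- The coefficient `ν` of `(∇_{αX} β) W - (∇_{αW} β) X = ν (g(X, y) W - g(W, y) X)`, where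
`α = endo a₁ b₁` and `β = endo a₃ b₃`. -/
noncomputable def nu : ℝ := K.A1 t * ddt K.a3 t - K.a1 t * K.b3 t

/-- The factor obtained on pairing the antisymmetrized derivative of `dJ_sub_dJ` with a horizontal
vector $Y^H$ under $G$. -/
noncomputable def sig : ℝ := K.c3 t * K.mu t - K.c1 t * K.nu t

/-- The same factor for the pairing with $JY^H$. -/
noncomputable def rho : ℝ := K.kap t * K.mu t - K.e t * K.nu t

theorem Compatible.ddt_a4 (hC : K.Compatible) {t : ℝ} (ht : 0 ≤ t) :
    ddt K.a4 t = -ddt K.a3 t := by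
  rw [ddt, ddt, ← derivWithin.fun_neg]
  exact derivWithin_congr (fun s hs => hC.a4_eq s hs) (hC.a4_eq t ht)

theorem Compatible.ddt_b4 (hC : K.Compatible) {t : ℝ} (ht : 0 ≤ t) :
    ddt K.b4 t = -ddt K.b3 t := by
  rw [ddt, ddt, ← derivWithin.fun_neg]
  exact derivWithin_congr (fun s hs => hC.b4_eq s hs) (hC.b4_eq t ht)

end Coeffs

/-! ### The cubic form `cubicForm` on $X^H+JW^H$. -/

section CubicForm

variable {E : Type*} [NormedAddCommGroup E] [NormedSpace ℝ E]
  {g : E → E →L[ℝ] E →L[ℝ] ℝ} {p : E × E} {K : Coeffs}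

theorem liftJ_hlift (hC : K.Compatible) (ht : 0 ≤ energy g p) (X : E) :
    liftJ K g p (hlift g p X) = vlift (endo g p (K.a1 (energy g p)) (K.b1 (energy g p)) X)
      - hlift g p (endo g p (K.a3 (energy g p)) (K.b3 (energy g p)) X) := by
  have h : ∀ a b, endo g p (-a) (-b) X = -endo g p a b X := by
    intro a b
    simp only [endo_apply]
    module
  rw [liftJ_apply, hpart_hlift, vpart_hlift, hC.a4_eq _ ht, hC.b4_eq _ ht, h]
  simp only [map_zero, add_zero]
  rw [sub_zero, map_neg, ← sub_eq_add_neg]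

theorem dJ_hlift (hC : K.Compatible) (ht : 0 ≤ energy g p) (B X : E) :
    dJ K g p B (hlift g p X) =
      vlift (dendo g p (K.b1 (energy g p)) (ddt K.a1 (energy g p)) (ddt K.b1 (energy g p)) B X)
      - hlift g p
        (dendo g p (K.b3 (energy g p)) (ddt K.a3 (energy g p)) (ddt K.b3 (energy g p)) B X) := by
  have h : ∀ b a' b', dendo g p (-b) (-a') (-b') B X = -dendo g p b a' b' B X := by
    intro b a' b'
    simp only [dendo]
    module
  have h0 : ∀ b a' b', dendo g p b a' b' B 0 = 0 := by
    intro b a' b'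
    simp [dendo]
  simp only [dJ]
  rw [hpart_hlift, vpart_hlift, hC.b4_eq _ ht, hC.ddt_a4 _ ht, hC.ddt_b4 _ ht, h, h0, h0]
  rw [add_zero, sub_zero, map_neg, ← sub_eq_add_neg]

/-- The cyclic sum of `F` on the diagonal, at the vector `X^H + J W^H`. -/
noncomputable def cubicForm (K : Coeffs) (g : E → E →L[ℝ] E →L[ℝ] ℝ) (p : E × E) (X W : E) : ℝ :=
  let t := energy g p
  let m := g p.1
  let y := p.2
  let β := endo g p (K.a3 t) (K.b3 t)
  let v := curvature g p.1 (-β X - W) (X - β W) y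
  (ddt K.c1 t * K.A1 t + 2 * K.d1 t * K.a1 t) * (m y X * m X X)
    + (ddt K.d1 t * K.A1 t + 2 * K.d1 t * K.b1 t) * m y X ^ 3
    + (2 * K.de t * K.A1 t - 2 * K.sig t) * (m y X * m X W)
    + (-K.de t * K.A1 t + 2 * K.f t * K.a1 t + 2 * K.sig t) * (m y W * m X X)
    + (K.df t * K.A1 t + 2 * K.f t * K.b1 t) * (m y X ^ 2 * m y W)
    + (2 * ddt K.c1 t * K.A1 t + 2 * K.rho t) * (m y W * m X W)
    + (-ddt K.c1 t * K.A1 t + 2 * K.d1 t * K.a1 t - 2 * K.rho t) * (m y X * m W W)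
    + (ddt K.d1 t * K.A1 t + 2 * K.d1 t * K.b1 t) * (m y X * m y W ^ 2)
    + (K.de t * K.A1 t + 2 * K.f t * K.a1 t) * (m y W * m W W)
    + (K.df t * K.A1 t + 2 * K.f t * K.b1 t) * m y W ^ 3
    + 2 * (K.c3 t * m v X + K.kap t * m v W)

theorem dform_eq_dG_hlift (B X Y : E) :
    dG K g p B (hlift g p X) (hlift g p Y) =
      dform g p (K.d1 (energy g p)) (ddt K.c1 (energy g p)) (ddt K.d1 (energy g p)) B X Y := by
  simp [dG, dform]

/-- By the Leibniz rule the left side differentiates $G(X^H,JY^H)$, which is again a natural form,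
with coefficients `Coeffs.e` and `Coeffs.f`. -/
theorem dform_eq_dG_liftJ (hs : ∀ v w, g p.1 v w = g p.1 w v) (hC : K.Compatible)
    (ht : 0 ≤ energy g p) (B X Y : E) :
    dG K g p B (hlift g p X) (liftJ K g p (hlift g p Y))
        + liftG K g p (hlift g p X) (dJ K g p B (hlift g p Y)) =
      dform g p (K.f (energy g p)) (K.de (energy g p)) (K.df (energy g p)) B X Y := by
  have hyy : g p.1 p.2 p.2 = 2 * energy g p := by rw [energy]; ring
  rw [liftJ_hlift hC ht, dJ_hlift hC ht, liftG_apply]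
  simp only [dG, hpart_hlift, vpart_hlift, map_sub, hpart_vlift, vpart_vlift,
    form_apply, dform, dendo, endo_apply, map_add, map_smul, smul_eq_mul, map_zero,
    zero_apply, hyy, hs B p.2, hs X p.2, hs X B]
  simp only [Coeffs.f, Coeffs.de, Coeffs.df, Coeffs.A1, Coeffs.A3]
  ring

/-- The antisymmetrization of the covariant derivative of `J` on horizontal vectors. -/
theorem dJ_sub_dJ (hs : ∀ v w, g p.1 v w = g p.1 w v) (hC : K.Compatible)
    (ht : 0 ≤ energy g p) (X W : E) :
    let α := endo g p (K.a1 (energy g p)) (K.b1 (energy g p))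
    dJ K g p (α X) (hlift g p W) - dJ K g p (α W) (hlift g p X) =
      K.mu (energy g p) • vlift (g p.1 p.2 X • W - g p.1 p.2 W • X)
        - K.nu (energy g p) • hlift g p (g p.1 p.2 X • W - g p.1 p.2 W • X) := by
  intro α
  have hyy : g p.1 p.2 p.2 = 2 * energy g p := by rw [energy]; ring
  rw [dJ_hlift hC ht, dJ_hlift hC ht, ← map_smul, ← map_smul, sub_sub_sub_comm, ← map_sub,
    ← map_sub]
  congr 2
  all_goals
    simp only [α, dendo, endo_apply, map_add, map_smul, add_apply, smul_apply, smul_eq_mul, hyy,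
      hs W X, Coeffs.mu, Coeffs.nu, Coeffs.A1]
    module

theorem liftG_vlift_hlift {v : E} (hv : g p.1 p.2 v = 0) (Y : E) :
    liftG K g p (vlift v) (hlift g p Y) = K.c3 (energy g p) * g p.1 v Y := by
  simp [liftG_apply, form_apply, hv]

theorem liftG_hlift_hlift {v : E} (hv : g p.1 p.2 v = 0) (Y : E) :
    liftG K g p (hlift g p v) (hlift g p Y) = K.c1 (energy g p) * g p.1 v Y := by
  simp [liftG_apply, form_apply, hv]

theorem liftG_vlift_liftJ (hs : ∀ v w, g p.1 v w = g p.1 w v) (hC : K.Compatible)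
    (ht : 0 ≤ energy g p) {v : E} (hv : g p.1 p.2 v = 0) (Y : E) :
    liftG K g p (vlift v) (liftJ K g p (hlift g p Y)) = K.kap (energy g p) * g p.1 v Y := by
  have hv' : g p.1 v p.2 = 0 := by rw [hs, hv]
  rw [liftJ_hlift hC ht]
  simp [liftG_apply, form_apply, endo_apply, hv, hv', Coeffs.kap]
  ring

theorem liftG_hlift_liftJ (hs : ∀ v w, g p.1 v w = g p.1 w v) (hC : K.Compatible)
    (ht : 0 ≤ energy g p) {v : E} (hv : g p.1 p.2 v = 0) (Y : E) :
    liftG K g p (hlift g p v) (liftJ K g p (hlift g p Y)) = K.e (energy g p) * g p.1 v Y := by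
  have hv' : g p.1 v p.2 = 0 := by rw [hs, hv]
  rw [liftJ_hlift hC ht]
  simp [liftG_apply, form_apply, endo_apply, hv, hv', Coeffs.e]
  ring

variable [FiniteDimensional ℝ E]

theorem tensorF_diag_eq_cubicForm (h : IsAntiHermitianNear K g p.1) (hg : IsRiemannianNear g p.1)
    (hK : K.Smooth) (hC : K.Compatible) (X W : E) :
    let u := hlift g p X + liftJ K g p (hlift g p W)
    tensorF (liftG K g) (liftJ K g) p u u u = cubicForm K g p X W := by
  intro u
  have ht := energy_nonneg (p := p) hg
  have hs := hg.symm.self_of_nhds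
  have hyy : g p.1 p.2 p.2 = 2 * energy g p := by rw [energy]; ring
  have hadj := h.eventually_adjoint.self_of_nhds
  have hGs := liftG_symm (K := K) hs
  have hsq := h.eventually_sq.self_of_nhds
  set α := endo g p (K.a1 (energy g p)) (K.b1 (energy g p)) with hα
  set β := endo g p (K.a3 (energy g p)) (K.b3 (energy g p)) with hβ
  have hJu : liftJ K g p u = liftJ K g p (hlift g p X) - hlift g p W := by
    rw [map_add, hsq, sub_eq_add_neg]
  have e1 : vpart g p u = α W := by
    simp [u, liftJ_hlift hC ht, α]
  have e2 : vpart g p (liftJ K g p u) = α X := by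
    rw [hJu]
    simp [liftJ_hlift hC ht, α]
  have e3 : hpart u = X - β W := by
    simp [u, liftJ_hlift hC ht, β, sub_eq_add_neg]
  have e4 : hpart (liftJ K g p u) = -β X - W := by
    rw [hJu]
    simp [liftJ_hlift hC ht, β]
  -- Trilinear expansion. `dJ_liftJ` and `dG_liftJ` remove derivatives at $JX^H$, $JW^H$, and the
  -- rest is grouped into derivatives of $G(X^H,Y^H)$ and $G(X^H,JY^H)$ and antisymmetrizations of
  -- `dJ`.
  have key : tensorF (liftG K g) (liftJ K g) p u u u =
      dG K g p (α X) (hlift g p X) (hlift g p X)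
      + 2 * (dG K g p (α X) (hlift g p X) (liftJ K g p (hlift g p W))
          + liftG K g p (hlift g p X) (dJ K g p (α X) (hlift g p W)))
      - (dG K g p (α W) (hlift g p X) (liftJ K g p (hlift g p X))
          + liftG K g p (hlift g p X) (dJ K g p (α W) (hlift g p X)))
      - 2 * liftG K g p (dJ K g p (α X) (hlift g p W) - dJ K g p (α W) (hlift g p X)) (hlift g p X)
      - dG K g p (α X) (hlift g p W) (hlift g p W)
      + 2 * dG K g p (α W) (hlift g p X) (hlift g p W)
      - 2 * liftG K g p (dJ K g p (α X) (hlift g p W) - dJ K g p (α W) (hlift g p X))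
          (liftJ K g p (hlift g p W))
      + (dG K g p (α W) (hlift g p W) (liftJ K g p (hlift g p W))
          + liftG K g p (hlift g p W) (dJ K g p (α W) (hlift g p W)))
      + 2 * (liftG K g p (vlift (curvature g p.1 (-β X - W) (X - β W) p.2)) (hlift g p X)
        + liftG K g p (vlift (curvature g p.1 (-β X - W) (X - β W) p.2))
            (liftJ K g p (hlift g p W))) := by
    have dr : ∀ B ξ ζ ζ', dG K g p B ξ (ζ + ζ') = dG K g p B ξ ζ + dG K g p B ξ ζ' := by
      intro B ξ ζ ζ'
      rw [dG_symm hs, dG_add_left, dG_symm hs B ζ, dG_symm hs B ζ']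
    rw [h.tensorF_diag_eq hg hK, e1, e2, e3, e4, hJu, sub_eq_add_neg (liftJ K g p _)]
    simp only [u, dG_add_left, dr, dG_neg_left, dJ_add, map_add, map_sub, add_apply, sub_apply,
      h.dJ_liftJ hg hK, h.dG_liftJ hg hK, map_neg, neg_apply, hadj, hsq]
    simp only [dG_symm hs _ (liftJ K g p _) (hlift g p _), dG_symm hs _ (hlift g p W) (hlift g p X),
      hGs (hlift g p _) (dJ K g p _ _), hGs (hlift g p _) (liftJ K g p (dJ K g p _ _)), hadj]
    ring
  set v := curvature g p.1 (-β X - W) (X - β W) p.2 with hv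
  -- Both the curvature vector and the vector of `dJ_sub_dJ` are orthogonal to $y$, so the rank-one
  -- parts of the natural tensors drop out when paired with them.
  have hvy : g p.1 p.2 v = 0 := by
    rw [hs]
    exact hg.curvature_skew _ _ _
  have hoy : g p.1 p.2 (g p.1 p.2 X • W - g p.1 p.2 W • X) = 0 := by
    simp only [map_sub, map_smul, smul_eq_mul]
    ring
  rw [key, dform_eq_dG_liftJ hs hC ht, dform_eq_dG_liftJ hs hC ht, dform_eq_dG_liftJ hs hC ht,
    dform_eq_dG_hlift, dform_eq_dG_hlift, dform_eq_dG_hlift, dJ_sub_dJ hs hC ht,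
    liftG_vlift_hlift hvy, liftG_vlift_liftJ hs hC ht hvy]
  simp only [map_sub (liftG K g p), map_smul (liftG K g p), sub_apply, smul_apply,
    liftG_vlift_hlift hoy, liftG_vlift_liftJ hs hC ht hoy, liftG_hlift_hlift hoy,
    liftG_hlift_liftJ hs hC ht hoy]
  rw [cubicForm]
  simp only [← hβ, ← hv]
  simp only [α, dform, endo_apply, map_add, map_sub, map_smul, add_apply, sub_apply, smul_apply,
    smul_eq_mul, hyy, hs W X, Coeffs.sig, Coeffs.rho, Coeffs.A1]
  ring

end CubicForm

end NaturalLift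
namespace NaturalLift

/-! ### Elimination between the six residual equations and the stated formulas. -/

section Relations

variable {a1 a3 b1 b3 c1 c3 d1 d3 a1' a3' b1' b3' c1' c3' d1' d3' c t κ : ℝ}

/-- The six equations between the coefficients, in the form in which they appear in the cyclic sum
of `F`, for a base manifold of constant sectional curvature `c`. -/
structure CyclicRelations
    (a1 a3 b1 b3 c1 c3 d1 d3 a1' a3' b1' b3' c1' c3' d1' d3' c t κ : ℝ) : Prop where
  c1_eq : c1' * (a1 + 2 * b1 * t) + 2 * d1 * a1 + 4 * c * c3 * b3 * t = 0
  d1_eq : d1' * (a1 + 2 * b1 * t) + 2 * d1 * b1 - 2 * c * c3 * b3 = 0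
  e_eq : (a1' * c3 + a1 * c3' - a3' * c1 - a3 * c1') * (a1 + 2 * b1 * t)
    + 2 * ((a1 + 2 * b1 * t) * d3 + b1 * c3 - (a3 + 2 * b3 * t) * d1 - b3 * c1) * a1
    + 4 * c * κ * b3 * t = 0
  f_eq : ((a1' + 2 * b1' * t + 2 * b1) * d3 + (a1 + 2 * b1 * t) * d3' + b1' * c3 + b1 * c3'
      - (a3' + 2 * b3' * t + 2 * b3) * d1 - (a3 + 2 * b3 * t) * d1' - b3' * c1 - b3 * c1')
        * (a1 + 2 * b1 * t)
    + 2 * ((a1 + 2 * b1 * t) * d3 + b1 * c3 - (a3 + 2 * b3 * t) * d1 - b3 * c1) * b1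
    - 2 * c * κ * b3 = 0
  sig_eq : c3 * ((a1 + 2 * b1 * t) * a1' - a1 * b1) - c1 * ((a1 + 2 * b1 * t) * a3' - a1 * b3)
    = (a1' * c3 + a1 * c3' - a3' * c1 - a3 * c1') * (a1 + 2 * b1 * t)
      - c * c3 * (1 + a3 * (a3 + 2 * b3 * t)) + 2 * c * κ * b3 * t
  rho_eq : κ * ((a1 + 2 * b1 * t) * a1' - a1 * b1)
      - (a1 * c3 - a3 * c1) * ((a1 + 2 * b1 * t) * a3' - a1 * b3)
    = -c1' * (a1 + 2 * b1 * t) - 2 * c * c3 * b3 * t - c * κ * (1 + a3 * (a3 + 2 * b3 * t))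

theorem cyclicRelations_iff (ha : a1 ≠ 0) (hA : a1 + 2 * b1 * t ≠ 0)
    (hN : c1 * (1 + a3 ^ 2) - a1 * a3 * c3 ≠ 0)
    (hκ : a1 * κ = a1 * a3 * c3 - (1 + a3 ^ 2) * c1) :
    CyclicRelations a1 a3 b1 b3 c1 c3 d1 d3 a1' a3' b1' b3' c1' c3' d1' d3' c t κ ↔
      QuasiRelations a1 a3 b1 b3 c1 c3 d1 d3 a1' a3' b1' b3' c1' c3' d1' d3' c t := by
  -- The expression is $c_1^2+(a_1c_3-a_3c_1)^2$; its vanishing would force $c_1=0$ and $a_1c_3=0$,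
  -- against `hN`.
  have hE : (1 + a3 ^ 2) * c1 ^ 2 - a1 * c3 * (2 * a3 * c1 - a1 * c3) ≠ 0 := by
    intro h
    have h1 : c1 ^ 2 + (a1 * c3 - a3 * c1) ^ 2 = 0 := by linear_combination h
    have h2 : c1 = 0 := by nlinarith [sq_nonneg c1, sq_nonneg (a1 * c3 - a3 * c1)]
    have h3 : a1 * c3 = 0 := by
      rw [h2] at h1
      have : (a1 * c3) ^ 2 = 0 := by linear_combination h1
      exact pow_eq_zero_iff (two_ne_zero) |>.1 this
    apply hN
    rw [h2]
    linear_combination (-a3) * h3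
  -- the relations with denominators cleared
  have r1 : (c1' = -(2 * (a1 * d1 + 2 * b3 * c * c3 * t)) / (a1 + 2 * b1 * t)) ↔
      c1' * (a1 + 2 * b1 * t) + 2 * d1 * a1 + 4 * c * c3 * b3 * t = 0 := by
    rw [eq_div_iff hA]
    constructor <;> intro h <;> linear_combination h
  have r2 : (d1' = 2 * (b3 * c * c3 - b1 * d1) / (a1 + 2 * b1 * t)) ↔
      d1' * (a1 + 2 * b1 * t) + 2 * d1 * b1 - 2 * c * c3 * b3 = 0 := by
    rw [eq_div_iff hA]
    constructor <;> intro h <;> linear_combination h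
  have r3 : (c3' = 2 * (1 + a3 ^ 2) * b3 * c * c1 * t / (a1 ^ 2 * (a1 + 2 * b1 * t))
    + (a1 * (b3 * c1 - b1 * c3 - 2 * a3 * d1) + c * c3 * (1 + a3 ^ 2 - 4 * a3 * b3 * t))
      / (a1 * (a1 + 2 * b1 * t))) ↔ a1 ^ 2 * (a1 + 2 * b1 * t) * c3' =
      2 * (1 + a3 ^ 2) * b3 * c * c1 * t + a1 * (a1 * (b3 * c1 - b1 * c3 - 2 * a3 * d1)
        + c * c3 * (1 + a3 ^ 2 - 4 * a3 * b3 * t)) := by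
    rw [div_add_div _ _ (by positivity) (by positivity), eq_div_iff (by positivity)]
    rw [← sub_eq_zero, ← sub_eq_zero (a := a1 ^ 2 * _ * c3')]
    constructor <;> intro h
    · refine (mul_eq_zero.1 (?_ : (a1 * (a1 + 2 * b1 * t)) * _ = 0)).resolve_left (by positivity)
      linear_combination h
    · linear_combination (a1 * (a1 + 2 * b1 * t)) * h
  have r4 : (a1' =
    a1 * (b1 * c1 * (1 + a3 ^ 2 + 2 * a3 * a3' * t)
        + 2 * (1 + a3 ^ 2) * c * c3 * (a3 - b3 * t))
      / ((c1 * (1 + a3 ^ 2) - a1 * a3 * c3) * (a1 + 2 * b1 * t))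
    - ((1 + a3 ^ 2) ^ 2 * c * c1 + a1 ^ 3 * ((a3' - b3) * c3 + a3 * c3'))
      / ((c1 * (1 + a3 ^ 2) - a1 * a3 * c3) * (a1 + 2 * b1 * t))
    - a1 ^ 2 * (2 * d1 + a3 * (2 * b1 * c3 + 2 * a3 * d1 - a3' * c1)
        + 2 * b1 * (a3' * c3 + a3 * c3') * t)
      / ((c1 * (1 + a3 ^ 2) - a1 * a3 * c3) * (a1 + 2 * b1 * t))) ↔
    a1' * ((c1 * (1 + a3 ^ 2) - a1 * a3 * c3) * (a1 + 2 * b1 * t)) =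
    a1 * (b1 * c1 * (1 + a3 ^ 2 + 2 * a3 * a3' * t)
        + 2 * (1 + a3 ^ 2) * c * c3 * (a3 - b3 * t))
    - ((1 + a3 ^ 2) ^ 2 * c * c1 + a1 ^ 3 * ((a3' - b3) * c3 + a3 * c3'))
    - a1 ^ 2 * (2 * d1 + a3 * (2 * b1 * c3 + 2 * a3 * d1 - a3' * c1)
        + 2 * b1 * (a3' * c3 + a3 * c3') * t) := by
    rw [← sub_div, ← sub_div, eq_div_iff (mul_ne_zero hN hA)]
  have r5 : (a3' =
    -(a1 * (1 + a3 ^ 2) * (b3 * (c1 ^ 2 + 2 * c * c3 ^ 2 * t + 4 * c1 * d1 * t)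
        + 2 * c1 * (a3 * d1 - b1 * (c3 + 2 * d3 * t))))
      / (((1 + a3 ^ 2) * c1 ^ 2 - a1 * c3 * (2 * a3 * c1 - a1 * c3)) * (a1 + 2 * b1 * t))
    + 2 * a1 ^ 2 * (c1 * d3 - c3 * d1 + a3 ^ 2 * (c3 * d1 + c1 * d3)
        - a3 * c3 * (b1 * (c3 + 2 * d3 * t) - 2 * b3 * d1 * t))
      / (((1 + a3 ^ 2) * c1 ^ 2 - a1 * c3 * (2 * a3 * c1 - a1 * c3)) * (a1 + 2 * b1 * t))
    + (a1 ^ 4 * c3 * (b3 * c3 - 2 * a3 * d3)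
        - 2 * (1 + a3 ^ 2) * b3 * c * c1 * t * (c1 * (1 + a3 ^ 2) - 2 * a1 * a3 * c3))
      / (a1 * ((1 + a3 ^ 2) * c1 ^ 2 - a1 * c3 * (2 * a3 * c1 - a1 * c3)) * (a1 + 2 * b1 * t))) ↔
    a3' * (a1 * ((1 + a3 ^ 2) * c1 ^ 2 - a1 * c3 * (2 * a3 * c1 - a1 * c3)) * (a1 + 2 * b1 * t)) =
    a1 * (-(a1 * (1 + a3 ^ 2) * (b3 * (c1 ^ 2 + 2 * c * c3 ^ 2 * t + 4 * c1 * d1 * t)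
        + 2 * c1 * (a3 * d1 - b1 * (c3 + 2 * d3 * t))))
    + 2 * a1 ^ 2 * (c1 * d3 - c3 * d1 + a3 ^ 2 * (c3 * d1 + c1 * d3)
        - a3 * c3 * (b1 * (c3 + 2 * d3 * t) - 2 * b3 * d1 * t)))
    + (a1 ^ 4 * c3 * (b3 * c3 - 2 * a3 * d3)
        - 2 * (1 + a3 ^ 2) * b3 * c * c1 * t * (c1 * (1 + a3 ^ 2) - 2 * a1 * a3 * c3)) := by
    generalize hEE : (1 + a3 ^ 2) * c1 ^ 2 - a1 * c3 * (2 * a3 * c1 - a1 * c3) = EE at hE ⊢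
    rw [← add_div, ← mul_div_mul_left _ _ ha, ← mul_assoc a1, ← add_div,
      eq_div_iff (mul_ne_zero (mul_ne_zero ha hE) hA)]
  have r6 : (d3' =
    (a3' * d1 - a1' * d3 + b3' * (c1 + 2 * d1 * t) - b1' * (c3 + 2 * d3 * t)
        + b1 * c3' - b3 * c1' - 2 * (a3 + 2 * b3 * t) * d1' - 2 * b3 * d1 - 4 * b1 * d3)
      / (a1 + 2 * b1 * t)
    - 2 * b3 * c * c1 * (1 + a3 ^ 2) / (a1 ^ 2 * (a1 + 2 * b1 * t))
    - 2 * c * c3 * (b1 * (1 + a3 ^ 2) - 4 * a3 * b3 * (a1 + b1 * t) - 2 * a1 * b3 ^ 2 * t)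
      / (a1 * (a1 + 2 * b1 * t) ^ 2)) ↔ d3' * (a1 ^ 2 * (a1 + 2 * b1 * t) ^ 2) =
    a1 ^ 2 * (a1 + 2 * b1 * t) *
      (a3' * d1 - a1' * d3 + b3' * (c1 + 2 * d1 * t) - b1' * (c3 + 2 * d3 * t)
        + b1 * c3' - b3 * c1' - 2 * (a3 + 2 * b3 * t) * d1' - 2 * b3 * d1 - 4 * b1 * d3)
    - (a1 + 2 * b1 * t) * (2 * b3 * c * c1 * (1 + a3 ^ 2))
    - a1 *
      (2 * c * c3 * (b1 * (1 + a3 ^ 2) - 4 * a3 * b3 * (a1 + b1 * t) - 2 * a1 * b3 ^ 2 * t)) := by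
    generalize a1 + 2 * b1 * t = A at hA ⊢
    rw [← eq_div_iff (by positivity)]
    have : ∀ x y z : ℝ, x / A - y / (a1 ^ 2 * A) - z / (a1 * A ^ 2) =
        (a1 ^ 2 * A * x - A * y - a1 * z) / (a1 ^ 2 * A ^ 2) := by
      intro x y z
      field_simp
    rw [this]
  constructor
  · rintro ⟨h1, h2, h3, h4, h5, h6⟩
    -- In `sig_eq` the terms in $a_1'$ and $a_3'$ cancel, leaving $c_3'$ in terms of $c_1'$.
    have k3 : a1 ^ 2 * (a1 + 2 * b1 * t) * c3' =
        2 * (1 + a3 ^ 2) * b3 * c * c1 * t + a1 * (a1 * (b3 * c1 - b1 * c3 - 2 * a3 * d1)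
          + c * c3 * (1 + a3 ^ 2 - 4 * a3 * b3 * t)) := by
      linear_combination (-a1) * h5 + a1 * a3 * h1 - 2 * c * b3 * t * hκ
    refine ⟨r1.2 h1, r2.2 h2, r4.2 ?_, r5.2 ?_, r3.2 k3, r6.2 ?_⟩
    · linear_combination (-a1) * h6 - a1 * a3 * h5 + a1 * (1 + a3 ^ 2) * h1
        + ((a1 + 2 * b1 * t) * a1' - a1 * b1 + c * (1 + a3 ^ 2)) * hκ
    -- The sum `h3 + h5` is free of $c_1'$ and $c_3'$. Eliminating $a_1'$ against `h6` leaves $a_3'$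
    -- multiplied, up to nonzero factors, by the expression of `hE`.
    · linear_combination (a1 * (a1 * a3 * c3 - (1 + a3 ^ 2) * c1)) * (h3 + h5)
        - a1 ^ 2 * c3 * h6 + a1 ^ 2 * c3 * h1
        + (a1 * c3 * ((a1 + 2 * b1 * t) * a1' - a1 * b1 + c * (1 + a3 * (a3 + 2 * b3 * t)))
          - 2 * c * b3 * t * (a1 * a3 * c3 - (1 + a3 ^ 2) * c1)) * hκ
    · linear_combination a1 ^ 2 * h4 - 2 * b1 * k3 + 2 * a1 ^ 2 * b3 * h1
        + 3 * a1 ^ 2 * (a3 + 2 * b3 * t) * h2 + 2 * c * b3 * a1 * hκ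
  · rintro ⟨h1, h2, h3, h4, h5, h6⟩
    rw [r1] at h1
    rw [r2] at h2
    rw [r3] at h5
    rw [r4] at h3
    rw [r5] at h4
    rw [r6] at h6
    have g5 : c3 * ((a1 + 2 * b1 * t) * a1' - a1 * b1) - c1 * ((a1 + 2 * b1 * t) * a3' - a1 * b3)
      = (a1' * c3 + a1 * c3' - a3' * c1 - a3 * c1') * (a1 + 2 * b1 * t)
        - c * c3 * (1 + a3 * (a3 + 2 * b3 * t)) + 2 * c * κ * b3 * t := by
      apply mul_left_cancel₀ ha
      linear_combination - h5 + a1 * a3 * h1 - 2 * c * b3 * t * hκ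
    have g6 : κ * ((a1 + 2 * b1 * t) * a1' - a1 * b1)
        - (a1 * c3 - a3 * c1) * ((a1 + 2 * b1 * t) * a3' - a1 * b3)
      = -c1' * (a1 + 2 * b1 * t) - 2 * c * c3 * b3 * t
        - c * κ * (1 + a3 * (a3 + 2 * b3 * t)) := by
      apply mul_left_cancel₀ ha
      linear_combination - h3 - a1 * a3 * g5 + a1 * (1 + a3 ^ 2) * h1
        + ((a1 + 2 * b1 * t) * a1' - a1 * b1 + c * (1 + a3 ^ 2)) * hκ
    have hP : a1 * (a1 * a3 * c3 - (1 + a3 ^ 2) * c1) ≠ 0 :=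
      mul_ne_zero ha fun h => hN (by linear_combination -h)
    refine ⟨h1, h2, ?_, ?_, g5, g6⟩
    · refine (mul_eq_zero.1 (?_ : (a1 * (a1 * a3 * c3 - (1 + a3 ^ 2) * c1)) * _ = 0)).resolve_left hP
      linear_combination h4 - (a1 * (a1 * a3 * c3 - (1 + a3 ^ 2) * c1)) * g5
        + a1 ^ 2 * c3 * g6 - a1 ^ 2 * c3 * h1
        - (a1 * c3 * ((a1 + 2 * b1 * t) * a1' - a1 * b1 + c * (1 + a3 * (a3 + 2 * b3 * t)))
          - 2 * c * b3 * t * (a1 * a3 * c3 - (1 + a3 ^ 2) * c1)) * hκ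
    · refine (mul_eq_zero.1 (?_ : a1 ^ 2 * _ = 0)).resolve_left (pow_ne_zero 2 ha)
      linear_combination h6 + 2 * b1 * h5 - 2 * a1 ^ 2 * b3 * h1
        - 3 * a1 ^ 2 * (a3 + 2 * b3 * t) * h2 - 2 * c * b3 * a1 * hκ

end Relations

end NaturalLift
-- The six residuals as functions of $t$, and continuity at $t=0$.
namespace NaturalLift

theorem eq_zero_of_eq_zero_of_pos {k : ℝ → ℝ} (hk : ContinuousOn k (Set.Ici 0))
    (h : ∀ t, 0 < t → k t = 0) {t : ℝ} (ht : 0 ≤ t) : k t = 0 := by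
  rcases ht.eq_or_lt with rfl | ht
  · have h1 : Filter.Tendsto k (𝓝[>] 0) (𝓝 (k 0)) :=
      (hk 0 (by simp)).mono_left (nhdsWithin_mono _ Set.Ioi_subset_Ici_self)
    have h2 : Filter.Tendsto k (𝓝[>] 0) (𝓝 0) :=
      tendsto_const_nhds.congr' (by filter_upwards [self_mem_nhdsWithin] with s hs using (h s hs).symm)
    exact tendsto_nhds_unique h1 h2
  · exact h t ht

namespace Coeffs

variable (K : Coeffs) (c t : ℝ)

/-- The coefficients of the cyclic sum of `F`, for a base manifold of constant sectional curvature
`c`. -/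
noncomputable def resC : ℝ :=
  ddt K.c1 t * K.A1 t + 2 * K.d1 t * K.a1 t + 4 * c * K.c3 t * K.b3 t * t

/-- See `resC`. -/
noncomputable def resD : ℝ :=
  ddt K.d1 t * K.A1 t + 2 * K.d1 t * K.b1 t - 2 * c * K.c3 t * K.b3 t

/-- See `resC`. -/
noncomputable def resE : ℝ :=
  K.de t * K.A1 t + 2 * K.f t * K.a1 t + 4 * c * K.kap t * K.b3 t * t

/-- See `resC`. -/
noncomputable def resF : ℝ :=
  K.df t * K.A1 t + 2 * K.f t * K.b1 t - 2 * c * K.kap t * K.b3 t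

/-- See `resC`. -/
noncomputable def resSig : ℝ :=
  K.sig t - K.de t * K.A1 t + c * K.c3 t * (1 + K.a3 t * K.A3 t) - 2 * c * K.kap t * K.b3 t * t

/-- See `resC`. -/
noncomputable def resRho : ℝ :=
  K.rho t + ddt K.c1 t * K.A1 t + 2 * c * K.c3 t * K.b3 t * t
    + c * K.kap t * (1 + K.a3 t * K.A3 t)

/-- The relations `CyclicRelations` for the coefficient functions `K` at the parameter `t`. -/
def SatisfiesCyclicRelations : Prop :=
  CyclicRelations (K.a1 t) (K.a3 t) (K.b1 t) (K.b3 t) (K.c1 t) (K.c3 t) (K.d1 t) (K.d3 t)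
    (ddt K.a1 t) (ddt K.a3 t) (ddt K.b1 t) (ddt K.b3 t)
    (ddt K.c1 t) (ddt K.c3 t) (ddt K.d1 t) (ddt K.d3 t) c t (K.kap t)

theorem satisfiesCyclicRelations_iff : K.SatisfiesCyclicRelations c t ↔
    K.resC c t = 0 ∧ K.resD c t = 0 ∧ K.resE c t = 0 ∧ K.resF c t = 0 ∧ K.resSig c t = 0 ∧
      K.resRho c t = 0 := by
  simp only [resC, resD, resE, resF, resSig, resRho, de, df, e, f, sig, rho, mu, nu, A1, A3]
  constructor
  · rintro ⟨h1, h2, h3, h4, h5, h6⟩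
    exact ⟨by linear_combination h1, by linear_combination h2, by linear_combination h3,
      by linear_combination h4, by linear_combination h5, by linear_combination h6⟩
  · rintro ⟨h1, h2, h3, h4, h5, h6⟩
    exact ⟨by linear_combination h1, by linear_combination h2, by linear_combination h3,
      by linear_combination h4, by linear_combination h5, by linear_combination h6⟩

variable {K c t}

theorem satisfiesCyclicRelations_iff_quasi (hC : K.Compatible) (ht : 0 ≤ t)
    (hN : K.c1 t * (1 + K.a3 t ^ 2) - K.a1 t * K.a3 t * K.c3 t ≠ 0) :
    K.SatisfiesCyclicRelations c t ↔ K.SatisfiesQuasiRelations c t := by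
  refine cyclicRelations_iff (hC.a1_ne t ht) (hC.A1_ne t ht) hN ?_
  rw [kap, hC.c2_eq t ht]
  linear_combination (-K.c1 t) * hC.a1_mul_a2 t ht

theorem continuousOn_ddt {k : ℝ → ℝ} (hk : ContDiffOn ℝ ∞ k (Set.Ici 0)) :
    ContinuousOn (ddt k) (Set.Ici 0) :=
  hk.continuousOn_derivWithin (uniqueDiffOn_Ici 0) (by simp)

/-- The coefficient functions and their derivatives are continuous on `[0, ∞)`. -/
structure ContinuousCoeffs (K : Coeffs) : Prop where
  a1 : ContinuousOn K.a1 (Set.Ici 0)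
  a3 : ContinuousOn K.a3 (Set.Ici 0)
  b1 : ContinuousOn K.b1 (Set.Ici 0)
  b3 : ContinuousOn K.b3 (Set.Ici 0)
  c1 : ContinuousOn K.c1 (Set.Ici 0)
  c3 : ContinuousOn K.c3 (Set.Ici 0)
  d1 : ContinuousOn K.d1 (Set.Ici 0)
  d3 : ContinuousOn K.d3 (Set.Ici 0)
  A1 : ContinuousOn K.A1 (Set.Ici 0)
  A3 : ContinuousOn K.A3 (Set.Ici 0)
  dc1 : ContinuousOn (ddt K.c1) (Set.Ici 0)
  dd1 : ContinuousOn (ddt K.d1) (Set.Ici 0)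
  kap : ContinuousOn K.kap (Set.Ici 0)
  f : ContinuousOn K.f (Set.Ici 0)
  de : ContinuousOn K.de (Set.Ici 0)
  df : ContinuousOn K.df (Set.Ici 0)
  sig : ContinuousOn K.sig (Set.Ici 0)
  rho : ContinuousOn K.rho (Set.Ici 0)

theorem Smooth.continuousCoeffs (hK : K.Smooth) : K.ContinuousCoeffs := by
  have a1 := hK.a1.continuousOn
  have a3 := hK.a3.continuousOn
  have b1 := hK.b1.continuousOn
  have b3 := hK.b3.continuousOn
  have c1 := hK.c1.continuousOn
  have c2 := hK.c2.continuousOn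
  have c3 := hK.c3.continuousOn
  have d1 := hK.d1.continuousOn
  have d3 := hK.d3.continuousOn
  have a1' := continuousOn_ddt hK.a1
  have a3' := continuousOn_ddt hK.a3
  have b1' := continuousOn_ddt hK.b1
  have b3' := continuousOn_ddt hK.b3
  have c1' := continuousOn_ddt hK.c1
  have c3' := continuousOn_ddt hK.c3
  have d1' := continuousOn_ddt hK.d1
  have d3' := continuousOn_ddt hK.d3
  have A1 : ContinuousOn K.A1 (Set.Ici 0) := by unfold Coeffs.A1; fun_prop
  have A3 : ContinuousOn K.A3 (Set.Ici 0) := by unfold Coeffs.A3; fun_prop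
  have kap : ContinuousOn K.kap (Set.Ici 0) := by unfold Coeffs.kap; fun_prop
  have e : ContinuousOn K.e (Set.Ici 0) := by unfold Coeffs.e; fun_prop
  have f : ContinuousOn K.f (Set.Ici 0) := by unfold Coeffs.f; fun_prop
  have de : ContinuousOn K.de (Set.Ici 0) := by unfold Coeffs.de; fun_prop
  have df : ContinuousOn K.df (Set.Ici 0) := by unfold Coeffs.df; fun_prop
  have mu : ContinuousOn K.mu (Set.Ici 0) := by unfold Coeffs.mu; fun_prop
  have nu : ContinuousOn K.nu (Set.Ici 0) := by unfold Coeffs.nu; fun_prop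
  have sig : ContinuousOn K.sig (Set.Ici 0) := by unfold Coeffs.sig; fun_prop
  have rho : ContinuousOn K.rho (Set.Ici 0) := by unfold Coeffs.rho; fun_prop
  exact ⟨a1, a3, b1, b3, c1, c3, d1, d3, A1, A3, c1', d1', kap, f, de, df, sig, rho⟩

/-- Needed because at $y=0$ every term of the cubic form vanishes and gives no information; the
residuals are continuous on $[0,\infty)$. -/
theorem satisfiesCyclicRelations_of_pos (hK : K.Smooth)
    (h : ∀ t, 0 < t → K.SatisfiesCyclicRelations c t) (ht : 0 ≤ t) :
    K.SatisfiesCyclicRelations c t := by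
  simp only [satisfiesCyclicRelations_iff] at h ⊢
  obtain ⟨a1, a3, b1, b3, c1, c3, d1, d3, A1, A3, c1', d1', kap, f, de, df, sig, rho⟩ :=
    hK.continuousCoeffs
  refine ⟨eq_zero_of_eq_zero_of_pos ?_ (fun s hs => (h s hs).1) ht,
    eq_zero_of_eq_zero_of_pos ?_ (fun s hs => (h s hs).2.1) ht,
    eq_zero_of_eq_zero_of_pos ?_ (fun s hs => (h s hs).2.2.1) ht,
    eq_zero_of_eq_zero_of_pos ?_ (fun s hs => (h s hs).2.2.2.1) ht,
    eq_zero_of_eq_zero_of_pos ?_ (fun s hs => (h s hs).2.2.2.2.1) ht,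
    eq_zero_of_eq_zero_of_pos ?_ (fun s hs => (h s hs).2.2.2.2.2) ht⟩
  · unfold resC; fun_prop
  · unfold resD; fun_prop
  · unfold resE; fun_prop
  · unfold resF; fun_prop
  · unfold resSig; fun_prop
  · unfold resRho; fun_prop

end Coeffs

/-! ### The cubic form, the sectional curvature and the coefficient relations. -/

section

variable {E : Type*} [NormedAddCommGroup E] [NormedSpace ℝ E]
  {g : E → E →L[ℝ] E →L[ℝ] ℝ} {K : Coeffs}

theorem cubicForm_eq_of_curvature_eq {p : E × E} (hs : ∀ v w, g p.1 v w = g p.1 w v) {c : ℝ}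
    (hc : ∀ u v w, curvature g p.1 u v w = c • (g p.1 v w • u - g p.1 u w • v)) (X W : E) :
    cubicForm K g p X W =
      g p.1 p.2 X * g p.1 X X * K.resC c (energy g p) + g p.1 p.2 X ^ 3 * K.resD c (energy g p)
      - 2 * (g p.1 p.2 X * g p.1 X W) * K.resSig c (energy g p)
      + g p.1 p.2 W * g p.1 X X * (K.resE c (energy g p) + 2 * K.resSig c (energy g p))
      + g p.1 p.2 X ^ 2 * g p.1 p.2 W * K.resF c (energy g p)
      + 2 * (g p.1 p.2 W * g p.1 X W) * K.resRho c (energy g p)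
      + g p.1 p.2 X * g p.1 W W * (K.resC c (energy g p) - 2 * K.resRho c (energy g p))
      + g p.1 p.2 X * g p.1 p.2 W ^ 2 * K.resD c (energy g p)
      + g p.1 p.2 W * g p.1 W W * K.resE c (energy g p)
      + g p.1 p.2 W ^ 3 * K.resF c (energy g p) := by
  have hyy : g p.1 p.2 p.2 = 2 * energy g p := by rw [energy]; ring
  rw [cubicForm]
  simp only [hc, endo_apply, map_add, map_sub, map_neg, map_smul, add_apply, sub_apply, neg_apply,
    smul_apply, smul_eq_mul, hyy, hs W X, hs X p.2, hs W p.2, Coeffs.resC, Coeffs.resD,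
    Coeffs.resE, Coeffs.resF, Coeffs.resSig, Coeffs.resRho, Coeffs.A3]
  ring

theorem exists_eq_hlift_add_liftJ (hC : K.Compatible) {p : E × E} (ht : 0 ≤ energy g p)
    (u : E × E) : ∃ X W, u = hlift g p X + liftJ K g p (hlift g p W) := by
  have ha := hC.a1_ne _ ht
  have hA := hC.A1_ne _ ht
  have hyy : g p.1 p.2 p.2 = 2 * energy g p := by rw [energy]; ring
  set a := K.a1 (energy g p)
  set b := K.b1 (energy g p)
  set Z := vpart g p u with hZ
  obtain ⟨W, hW⟩ : ∃ W, endo g p a b W = Z := by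
    obtain ⟨A, hAd⟩ : ∃ A, A = a + 2 * b * energy g p := ⟨_, rfl⟩
    rw [← hAd] at hA
    -- Inverse of a rank-one perturbation of $a\cdot\mathrm{id}$, whose eigenvalue on $y$ is
    -- $A=a+2bt$.
    refine ⟨a⁻¹ • Z - (b * g p.1 p.2 Z / (a * A)) • p.2, ?_⟩
    simp only [endo_apply, map_sub, map_smul, hyy]
    match_scalars
    · field_simp
    · field_simp
      linear_combination (b * g p.1 p.2 Z) * hAd
  refine ⟨hpart u + endo g p (K.a3 (energy g p)) (K.b3 (energy g p)) W, W, ?_⟩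
  rw [liftJ_hlift hC ht, hW]
  conv_lhs => rw [← hlift_hpart_add_vlift_vpart g p u]
  rw [map_add, ← hZ]
  abel

variable [FiniteDimensional ℝ E]

theorem exists_orthogonal_ne_zero (hn : 2 ≤ Module.finrank ℝ E) (l : E →L[ℝ] ℝ) :
    ∃ w : E, w ≠ 0 ∧ l w = 0 := by
  have h1 := LinearMap.finrank_range_add_finrank_ker (l : E →ₗ[ℝ] ℝ)
  have h2 : Module.finrank ℝ (LinearMap.range (l : E →ₗ[ℝ] ℝ)) ≤ 1 := by
    simpa using Submodule.finrank_le (LinearMap.range (l : E →ₗ[ℝ] ℝ))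
  have h3 : 0 < Module.finrank ℝ (LinearMap.ker (l : E →ₗ[ℝ] ℝ)) := by omega
  obtain ⟨⟨w, hw⟩, hw0⟩ := Module.finrank_pos_iff_exists_ne_zero.1 h3
  exact ⟨w, fun h => hw0 (by simpa using h), by simpa using hw⟩

theorem exists_energy_eq (hn : 2 ≤ Module.finrank ℝ E) {x : E} (hg : IsRiemannianNear g x) {t : ℝ}
    (ht : 0 ≤ t) : ∃ y, energy g (x, y) = t := by
  obtain ⟨w, hw, -⟩ := exists_orthogonal_ne_zero hn (0 : E →L[ℝ] ℝ)
  have hpos := hg.pos.self_of_nhds w hw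
  refine ⟨√(2 * t / g x w w) • w, ?_⟩
  simp only [energy, map_smul, smul_apply, smul_eq_mul]
  rw [← mul_assoc, Real.mul_self_sqrt (by positivity)]
  field_simp

theorem IsAntiHermitianNear.compatible (hn : 2 ≤ Module.finrank ℝ E) {x : E}
    (h : IsAntiHermitianNear K g x) (hg : IsRiemannianNear g x) (hK : K.Smooth) :
    K.Compatible := by
  have hs := hg.symm.self_of_nhds
  -- On a common eigenvector `w`, $J$ preserves the plane of $w^H,w^V$ and acts by a real $2\times2$
  -- matrix with square $-1$: trace $0$, determinant $1$. Here $A_1=0$ would give $A_4^2=-1$.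
  have eig : ∀ (y w : E), w ≠ 0 → ∀ A1 A2 A3 A4 : ℝ,
      endo g (x, y) (K.a1 (energy g (x, y))) (K.b1 (energy g (x, y))) w = A1 • w →
      endo g (x, y) (K.a2 (energy g (x, y))) (K.b2 (energy g (x, y))) w = A2 • w →
      endo g (x, y) (K.a3 (energy g (x, y))) (K.b3 (energy g (x, y))) w = A3 • w →
      endo g (x, y) (K.a4 (energy g (x, y))) (K.b4 (energy g (x, y))) w = A4 • w →
      A1 ≠ 0 ∧ A4 = -A3 ∧ A1 * A2 = 1 + A3 ^ 2 := by
    intro y w hw A1 A2 A3 A4 e1 e2 e3 e4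
    have hsq := h.sq_J.self_of_nhds y (hlift g (x, y) w)
    have hJw : liftJ K g (x, y) (hlift g (x, y) w) =
        vlift (A1 • w) + hlift g (x, y) (A4 • w) := by
      rw [liftJ_apply, hpart_hlift, vpart_hlift, e1, e4]
      simp
    rw [hJw, liftJ_apply] at hsq
    have hv := congrArg (vpart g (x, y)) hsq
    have hh := congrArg hpart hsq
    simp only [map_add, hpart_vlift, hpart_hlift, vpart_hlift, vpart_vlift, smul_zero,
      zero_add, add_zero, map_smul, e1, e2, e3, e4, map_neg, neg_zero, map_sub, smul_smul,
      sub_zero] at hv hh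
    rw [← add_smul] at hv
    rw [← sub_smul] at hh
    have e5 : A4 * A1 + A1 * A3 = 0 := (smul_eq_zero.1 hv).resolve_right hw
    have e6 : A4 * A4 - A1 * A2 + 1 = 0 := by
      refine (smul_eq_zero.1 (?_ : _ • w = 0)).resolve_right hw
      rw [add_smul, hh]
      simp
    have hA : A1 ≠ 0 := by
      rintro rfl
      nlinarith [sq_nonneg A4]
    have e7 : A4 = -A3 := by
      apply mul_left_cancel₀ hA
      linear_combination e5
    refine ⟨hA, e7, ?_⟩
    rw [e7] at e6
    linear_combination -e6
  have perp : ∀ t, 0 ≤ t → K.a1 t ≠ 0 ∧ K.a4 t = -K.a3 t ∧ K.a1 t * K.a2 t = 1 + K.a3 t ^ 2 ∧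
      K.a1 t * K.c2 t - K.a3 t * K.c3 t = K.a3 t * K.c3 t - K.a2 t * K.c1 t := by
    intro t ht
    obtain ⟨y, rfl⟩ := exists_energy_eq hn hg ht
    obtain ⟨w, hw, hyw⟩ := exists_orthogonal_ne_zero hn (g x y)
    have e : ∀ a b, endo g (x, y) a b w = a • w := by
      intro a b
      simp [endo_apply, hyw]
    obtain ⟨h1, h2, h3⟩ := eig y w hw _ _ _ _ (e _ _) (e _ _) (e _ _) (e _ _)
    refine ⟨h1, h2, h3, ?_⟩
    -- Self-adjointness of $J$ on the pair $w^H,w^V$ gives the relation for $c_2$.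
    have hadj := (h.eventually_adjoint (p := (x, y))).self_of_nhds (hlift g (x, y) w) (vlift w)
    rw [liftJ_apply, liftJ_apply] at hadj
    simp only [hpart_vlift, hpart_hlift, vpart_hlift, vpart_vlift, e, map_zero, zero_add, add_zero,
      sub_zero, zero_sub] at hadj
    simp only [liftG_apply, map_add, map_neg, map_smul, add_apply, smul_apply,
      hpart_vlift, hpart_hlift, vpart_hlift, vpart_vlift, map_zero, zero_apply, form_apply, hyw,
      smul_eq_mul, h2] at hadj
    have hpos := hg.pos.self_of_nhds w hw
    apply mul_right_cancel₀ hpos.ne'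
    linear_combination hadj
  have par : ∀ t, 0 < t → K.A1 t ≠ 0 ∧ K.a4 t + 2 * K.b4 t * t = -(K.a3 t + 2 * K.b3 t * t) := by
    intro t ht
    obtain ⟨y, rfl⟩ := exists_energy_eq hn hg ht.le
    have hy : y ≠ 0 := by
      rintro rfl
      simp [energy] at ht
    have e : ∀ a b, endo g (x, y) a b y = (a + 2 * b * energy g (x, y)) • y := by
      intro a b
      rw [endo_apply, energy]
      module
    obtain ⟨h1, h2, -⟩ := eig y y hy _ _ _ _ (e _ _) (e _ _) (e _ _) (e _ _)
    exact ⟨h1, h2⟩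
  -- Comparing eigenvalues on $y$ and on $y^\perp$ gives $2t(b_4+b_3)=0$, so $t=0$ is reached only
  -- by continuity.
  have b4 : ∀ t, 0 ≤ t → K.b4 t + K.b3 t = 0 := by
    intro t ht
    refine eq_zero_of_eq_zero_of_pos (hK.b4.continuousOn.add hK.b3.continuousOn) (fun s hs => ?_) ht
    have h1 := (par s hs).2
    rw [(perp s hs.le).2.1] at h1
    refine (mul_eq_zero.1 (?_ : (2 * s) * _ = 0)).resolve_left (by positivity)
    simp only [Pi.add_apply]
    linear_combination h1
  refine ⟨fun t ht => (perp t ht).2.1, fun t ht => by linear_combination b4 t ht,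
    fun t ht => (perp t ht).2.2.1, fun t ht => (perp t ht).2.2.2, fun t ht => (perp t ht).1,
    fun t ht => ?_⟩
  rcases ht.eq_or_lt with rfl | ht
  · simpa using (perp 0 le_rfl).1
  · exact (par t ht).1

theorem satisfiesCyclicRelations_of_cubicForm (hn : 2 ≤ Module.finrank ℝ E) {p : E × E}
    (hg : IsRiemannianNear g p.1) {c : ℝ}
    (hc : ∀ u v w, curvature g p.1 u v w = c • (g p.1 v w • u - g p.1 u w • v)) (hy : p.2 ≠ 0)
    (h : ∀ X W, cubicForm K g p X W = 0) : K.SatisfiesCyclicRelations c (energy g p) := by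
  have hs := hg.symm.self_of_nhds
  obtain ⟨w, hw, hyw⟩ := exists_orthogonal_ne_zero hn (g p.1 p.2)
  have hτ := hg.pos.self_of_nhds p.2 hy
  have hσ := hg.pos.self_of_nhds w hw
  have hwy : g p.1 w p.2 = 0 := by rw [hs, hyw]
  simp only [cubicForm_eq_of_curvature_eq hs hc] at h
  -- With $w\perp y$ these six choices of $(X,W)$ give a triangular system for the residuals.
  have t1 := h p.2 0
  have t2 := h (p.2 + w) 0
  have t3 := h 0 p.2
  have t4 := h 0 (p.2 + w)
  have t5 := h w p.2
  have t6 := h w (p.2 + w)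
  rw [Coeffs.satisfiesCyclicRelations_iff]
  simp only [map_add, add_apply, hyw, hwy, map_zero, zero_apply, zero_mul, mul_zero, add_zero,
    zero_add, sub_zero, ne_eq, OfNat.ofNat_ne_zero, not_false_eq_true, zero_pow] at t1 t2 t3 t4 t5 t6
  generalize g p.1 p.2 p.2 = τ at *
  generalize g p.1 w w = σ at *
  have h1 : K.resC c (energy g p) = 0 := by
    refine (mul_eq_zero.1 (?_ : (τ * σ) * _ = 0)).resolve_left (by positivity)
    linear_combination t2 - t1
  have h2 : K.resD c (energy g p) = 0 := by
    refine (mul_eq_zero.1 (?_ : τ ^ 3 * _ = 0)).resolve_left (by positivity)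
    linear_combination t1 - τ * τ * h1
  have h3 : K.resE c (energy g p) = 0 := by
    refine (mul_eq_zero.1 (?_ : (τ * σ) * _ = 0)).resolve_left (by positivity)
    linear_combination t4 - t3
  have h4 : K.resF c (energy g p) = 0 := by
    refine (mul_eq_zero.1 (?_ : τ ^ 3 * _ = 0)).resolve_left (by positivity)
    linear_combination t3 - τ * τ * h3
  have h5 : K.resSig c (energy g p) = 0 := by
    refine (mul_eq_zero.1 (?_ : (2 * τ * σ) * _ = 0)).resolve_left (by positivity)
    linear_combination t5 - (τ * σ + τ * τ) * h3 - τ ^ 3 * h4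
  have h6 : K.resRho c (energy g p) = 0 := by
    refine (mul_eq_zero.1 (?_ : (2 * τ * σ) * _ = 0)).resolve_left (by positivity)
    linear_combination t6 - (τ * σ + τ * (τ + σ)) * h3 - τ ^ 3 * h4 - 2 * τ * σ * h5
  exact ⟨h1, h2, h3, h4, h5, h6⟩

/-- The sectional curvature of the base of a quasi-anti-Kähler structure. -/
noncomputable def Coeffs.sectionalCurvature (K : Coeffs) : ℝ :=
  (-ddt K.c1 0 * K.A1 0 + 2 * K.d1 0 * K.a1 0 - 2 * K.rho 0) / (2 * K.kap 0 * (1 + K.a3 0 ^ 2))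

theorem curvature_of_cubicForm (hn : 2 ≤ Module.finrank ℝ E) {x : E} (hg : IsRiemannianNear g x)
    (hK : K.Smooth) (hκ : K.kap 0 ≠ 0) (h : ∀ y X W, cubicForm K g (x, y) X W = 0) (u v : E) :
    g x (curvature g x u v v) u =
      K.sectionalCurvature * (g x u u * g x v v - g x u v ^ 2) := by
  have hs := hg.symm.self_of_nhds
  obtain ⟨a1, a3, b1, b3, c1, c3, d1, d3, A1, A3, c1', d1', kap, f, de, df, sig, rho⟩ :=
    hK.continuousCoeffs
  -- the limit of the equations for `y = s X` as `s → 0`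
  have lim : ∀ X W : E,
      (ddt K.c1 0 * K.A1 0 + 2 * K.d1 0 * K.a1 0) * (g x X X * g x X X)
      + (2 * K.de 0 * K.A1 0 - 2 * K.sig 0) * (g x X X * g x X W)
      + (-K.de 0 * K.A1 0 + 2 * K.f 0 * K.a1 0 + 2 * K.sig 0) * (g x X W * g x X X)
      + (2 * ddt K.c1 0 * K.A1 0 + 2 * K.rho 0) * (g x X W * g x X W)
      + (-ddt K.c1 0 * K.A1 0 + 2 * K.d1 0 * K.a1 0 - 2 * K.rho 0) * (g x X X * g x W W)
      + (K.de 0 * K.A1 0 + 2 * K.f 0 * K.a1 0) * (g x X W * g x W W)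
      + 2 * K.kap 0 * (1 + K.a3 0 ^ 2) * g x (curvature g x X W X) W = 0 := by
    intro X W
    have hP : ∀ s : ℝ, 0 ≤ s → 0 ≤ s * g x X X / 2 := fun s hs =>
      div_nonneg (mul_nonneg hs (hg.nonneg X)) (by norm_num)
    have hcont : ∀ {k : ℝ → ℝ}, ContinuousOn k (Set.Ici 0) →
        ContinuousOn (fun s => k (s * g x X X / 2)) (Set.Ici 0) := by
      intro k hk
      exact hk.comp (by fun_prop) hP
    -- For $s>0$ this is the cubic form at $y=\sqrt s\,X$ divided by $\sqrt s$. Terms cubic in $y$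
    -- keep a factor $s$, and by `hR` the curvature enters only through $R(X,W)X$, because $y$ is
    -- parallel to $X$.
    let Ψ : ℝ → ℝ := fun s =>
      let t := s * g x X X / 2
      (ddt K.c1 t * K.A1 t + 2 * K.d1 t * K.a1 t) * (g x X X * g x X X)
      + s * ((ddt K.d1 t * K.A1 t + 2 * K.d1 t * K.b1 t) * (g x X X) ^ 3)
      + (2 * K.de t * K.A1 t - 2 * K.sig t) * (g x X X * g x X W)
      + (-K.de t * K.A1 t + 2 * K.f t * K.a1 t + 2 * K.sig t) * (g x X W * g x X X)
      + s * ((K.df t * K.A1 t + 2 * K.f t * K.b1 t) * ((g x X X) ^ 2 * g x X W))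
      + (2 * ddt K.c1 t * K.A1 t + 2 * K.rho t) * (g x X W * g x X W)
      + (-ddt K.c1 t * K.A1 t + 2 * K.d1 t * K.a1 t - 2 * K.rho t) * (g x X X * g x W W)
      + s * ((ddt K.d1 t * K.A1 t + 2 * K.d1 t * K.b1 t) * (g x X X * (g x X W) ^ 2))
      + (K.de t * K.A1 t + 2 * K.f t * K.a1 t) * (g x X W * g x W W)
      + s * ((K.df t * K.A1 t + 2 * K.f t * K.b1 t) * (g x X W) ^ 3)
      + 2 * K.kap t * (1 + K.a3 t ^ 2 + s * (K.b3 t * (g x X X * K.a3 t - g x X W)))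
          * g x (curvature g x X W X) W
    have hΨ : Ψ 0 = 0 := by
      refine eq_zero_of_eq_zero_of_pos (k := Ψ) ?_ (fun s hs0 => ?_) le_rfl
      · have := hcont a1
        have := hcont a3
        have := hcont b1
        have := hcont b3
        have := hcont d1
        have := hcont A1
        have := hcont c1'
        have := hcont d1'
        have := hcont kap
        have := hcont f
        have := hcont de
        have := hcont df
        have := hcont sig
        have := hcont rho
        simp only [Ψ]
        fun_prop
      · have hr : √s ≠ 0 := (Real.sqrt_pos.2 hs0).ne'
        have hrr : √s ^ 2 = s := Real.sq_sqrt hs0.le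
        have ht : energy g (x, √s • X) = s * g x X X / 2 := by
          simp only [energy, map_smul, smul_apply, smul_eq_mul]
          linear_combination (g x X X / 2) * hrr
        have h1 := h (√s • X) X W
        have hR : ∀ k l m n : ℝ, curvature g x (-(k • X) - l • W) (m • X - n • W) (√s • X) =
            (√s * (k * n + l * m)) • curvature g x X W X := by
          intro k l m n
          have h0 : ∀ z w, curvature g x z z w = 0 := by
            intro z w
            simp [curvature]
          rw [curvature_smul_third, sub_eq_add_neg, sub_eq_add_neg, ← neg_smul, ← neg_smul,
            ← neg_smul]
          simp only [curvature_add_left, curvature_add_right, curvature_smul_left,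
            curvature_smul_right, h0, curvature_skew_left W X]
          module
        have hsk : g x (curvature g x X W X) X = 0 := hg.curvature_skew _ _ _
        refine (mul_eq_zero.1 (?_ : √s * _ = 0)).resolve_left hr
        rw [← h1, cubicForm]
        have e1 : -(endo g (x, √s • X) (K.a3 (s * g x X X / 2)) (K.b3 (s * g x X X / 2)) X) - W =
            -((K.a3 (s * g x X X / 2) + K.b3 (s * g x X X / 2) * s * g x X X) • X)
              - (1 : ℝ) • W := by
          rw [endo_apply]
          simp only [map_smul, smul_apply, smul_eq_mul, smul_smul]
          rw [show K.b3 (s * g x X X / 2) * s * g x X X =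
            K.b3 (s * g x X X / 2) * (√s * g x X X) * √s by
              linear_combination (-K.b3 (s * g x X X / 2) * g x X X) * hrr]
          module
        have e2 : X - endo g (x, √s • X) (K.a3 (s * g x X X / 2)) (K.b3 (s * g x X X / 2)) W =
            (1 - K.b3 (s * g x X X / 2) * s * g x X W) • X - K.a3 (s * g x X X / 2) • W := by
          rw [endo_apply]
          simp only [map_smul, smul_apply, smul_eq_mul, smul_smul]
          rw [show K.b3 (s * g x X X / 2) * s * g x X W =
            K.b3 (s * g x X X / 2) * (√s * g x X W) * √s by
              linear_combination (-K.b3 (s * g x X X / 2) * g x X W) * hrr]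
          module
        simp only [ht, e1, e2, hR, Ψ]
        simp only [map_smul, smul_apply, smul_eq_mul, hsk]
        generalize √s = r at hrr
        rw [← hrr]
        ring
    simpa [Ψ] using hΨ
  -- Averaging over $\pm W$ removes the odd terms, and subtracting the case $W=0$ removes the term
  -- in $X$ alone.
  have even : ∀ X W : E, (2 * ddt K.c1 0 * K.A1 0 + 2 * K.rho 0) * (g x X W * g x X W)
      + (-ddt K.c1 0 * K.A1 0 + 2 * K.d1 0 * K.a1 0 - 2 * K.rho 0) * (g x X X * g x W W)
      + 2 * K.kap 0 * (1 + K.a3 0 ^ 2) * g x (curvature g x X W X) W = 0 := by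
    intro X W
    have h1 := lim X W
    have h2 := lim X (-W)
    have h3 := lim X 0
    have e : curvature g x X (-W) X = -curvature g x X W X := by
      have := curvature_smul_right (h := g) (p := x) X W X (-1)
      simpa using this
    rw [e] at h2
    simp only [map_neg, neg_apply, map_zero] at h2 h3
    linear_combination (1 / 2) * h1 + (1 / 2) * h2 - h3
  obtain ⟨w, hw, -⟩ := exists_orthogonal_ne_zero hn (0 : E →L[ℝ] ℝ)
  have hpos := hg.pos.self_of_nhds w hw
  have hww := even w w
  -- The case $X=W$ has no curvature; hence the two coefficients are opposite and combine to a
  -- multiple of $g(X,X)g(W,W)-g(X,W)^2$.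
  have hsum : (2 * ddt K.c1 0 * K.A1 0 + 2 * K.rho 0)
      + (-ddt K.c1 0 * K.A1 0 + 2 * K.d1 0 * K.a1 0 - 2 * K.rho 0) = 0 := by
    rw [hg.curvature_skew] at hww
    refine (mul_eq_zero.1 (?_ : (g x w w * g x w w) * _ = 0)).resolve_left (by positivity)
    linear_combination hww
  have huv := even v u
  rw [curvature_skew_left v u] at huv
  simp only [map_neg, neg_apply] at huv
  rw [Coeffs.sectionalCurvature, div_mul_eq_mul_div, eq_div_iff (by positivity), hs u v]
  linear_combination (-1) * huv + (g x v u) ^ 2 * hsum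

end

end NaturalLift
namespace NaturalLift

/-! ### From the manifold to charts. -/

section

variable {E : Type*} [NormedAddCommGroup E] [NormedSpace ℝ E]
  {M : Type*} [TopologicalSpace M] [ChartedSpace E M] [IsManifold 𝓘(ℝ, E) ∞ M]
  {g : Bundle.ContMDiffRiemannianMetric 𝓘(ℝ, E) ∞ E (fun x : M => TangentSpace 𝓘(ℝ, E) x)}
  {φ : OpenPartialHomeomorph M E}

/-- The tangent map of the smooth `φ.symm` is composed with the constant section `u`; this provides
the coordinate fields on which the metric is evaluated. -/
theorem contMDiffOn_mfderiv_symm (hφ : φ ∈ IsManifold.maximalAtlas 𝓘(ℝ, E) ∞ M) (u : E) :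
    ContMDiffOn 𝓘(ℝ, E) 𝓘(ℝ, E).tangent ∞
      (fun q => (⟨φ.symm q, mfderiv 𝓘(ℝ, E) 𝓘(ℝ, E) φ.symm q u⟩ : TangentBundle 𝓘(ℝ, E) M))
      φ.target := by
  have h0 := contMDiffOn_symm_of_mem_maximalAtlas hφ
  have h1 := h0.contMDiffOn_tangentMapWithin (m := ∞) (by simp) φ.open_target.uniqueMDiffOn
  have h2 : ContMDiff 𝓘(ℝ, E) 𝓘(ℝ, E).tangent ∞
      (fun q => (⟨q, u⟩ : TangentBundle 𝓘(ℝ, E) E)) :=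
    contMDiff_vectorSpace_iff_contDiff (V := fun _ => u).2 contDiff_const
  refine (h1.comp h2.contMDiffOn (s := φ.target) fun q hq => hq).congr fun q hq => ?_
  simp only [tangentMapWithin, Function.comp_apply]
  rw [mfderivWithin_of_isOpen φ.open_target hq]

theorem contDiffOn_metricInChart_apply (g : Bundle.ContMDiffRiemannianMetric 𝓘(ℝ, E) ∞ E
      (fun x : M => TangentSpace 𝓘(ℝ, E) x))
    (hφ : φ ∈ IsManifold.maximalAtlas 𝓘(ℝ, E) ∞ M) (u v : E) :
    ContDiffOn ℝ ∞ (fun q => metricInChart g φ q u v) φ.target := by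
  rw [← contMDiffOn_iff_contDiffOn]
  intro q hq
  have h : ContMDiffWithinAt 𝓘(ℝ, E) (𝓘(ℝ, E).prod 𝓘(ℝ)) ∞
      (fun q => Bundle.TotalSpace.mk' ℝ (E := Bundle.Trivial M ℝ) (φ.symm q)
        (g.inner (φ.symm q) (mfderiv 𝓘(ℝ, E) 𝓘(ℝ, E) φ.symm q u)
          (mfderiv 𝓘(ℝ, E) 𝓘(ℝ, E) φ.symm q v))) φ.target q := by
    apply ContMDiffWithinAt.clm_bundle_apply₂ (F₁ := E) (F₂ := E)
    · exact ContMDiffAt.comp_contMDiffWithinAt q g.contMDiff.contMDiffAt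
        (contMDiffOn_symm_of_mem_maximalAtlas hφ q hq)
    · exact contMDiffOn_mfderiv_symm hφ u q hq
    · exact contMDiffOn_mfderiv_symm hφ v q hq
  simp only [Bundle.contMDiffWithinAt_totalSpace] at h
  exact h.2

theorem metricInChart_self_pos (g : Bundle.ContMDiffRiemannianMetric 𝓘(ℝ, E) ∞ E
      (fun x : M => TangentSpace 𝓘(ℝ, E) x))
    (hφ : φ ∈ IsManifold.maximalAtlas 𝓘(ℝ, E) ∞ M) {q : E} (hq : q ∈ φ.target) {v : E}
    (hv : v ≠ 0) : 0 < metricInChart g φ q v v := by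
  rw [metricInChart_apply]
  refine g.pos _ _ fun h0 => hv ?_
  have hd : φ.symm.MDifferentiable 𝓘(ℝ, E) 𝓘(ℝ, E) :=
    ⟨(contMDiffOn_symm_of_mem_maximalAtlas hφ).mdifferentiableOn (by simp),
      (contMDiffOn_of_mem_maximalAtlas hφ).mdifferentiableOn (by simp)⟩
  have hinj := hd.mfderiv_injective hq
  rw [← map_zero (mfderiv 𝓘(ℝ, E) 𝓘(ℝ, E) φ.symm q)] at h0
  exact hinj h0

theorem isRiemannianNear_metricInChart [FiniteDimensional ℝ E]
    (g : Bundle.ContMDiffRiemannianMetric 𝓘(ℝ, E) ∞ E (fun x : M => TangentSpace 𝓘(ℝ, E) x))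
    (hφ : φ ∈ IsManifold.maximalAtlas 𝓘(ℝ, E) ∞ M) {x : E} (hx : x ∈ φ.target) :
    IsRiemannianNear (metricInChart g φ) x where
  contDiffAt := by
    have h : ContDiffOn ℝ ∞ (metricInChart g φ) φ.target :=
      contDiffOn_clm_apply.2 fun u => contDiffOn_clm_apply.2 fun v =>
        contDiffOn_metricInChart_apply g hφ u v
    exact (h.contDiffAt (φ.open_target.mem_nhds hx)).of_le ENat.LEInfty.out
  symm := Filter.Eventually.of_forall fun q v w => by
    rw [metricInChart_apply, metricInChart_apply, g.symm]
  pos := by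
    filter_upwards [φ.open_target.mem_nhds hx] with q hq v hv
    exact metricInChart_self_pos g hφ hq hv

variable {K : Coeffs}

theorem IsAlmostAntiHermitian.isAntiHermitianNear (h : IsAlmostAntiHermitian g K)
    (hφ : φ ∈ IsManifold.maximalAtlas 𝓘(ℝ, E) ∞ M) {x : E} (hx : x ∈ φ.target) :
    IsAntiHermitianNear K (metricInChart g φ) x where
  sq_J := by
    filter_upwards [φ.open_target.mem_nhds hx] with q hq using h.sq_J φ hφ q hq
  nondegenerate := h.nondegenerate φ hφ x hx
  anti := by
    filter_upwards [φ.open_target.mem_nhds hx] with q hq using h.antiHermitian φ hφ q hq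

/-- Pointwise combination of polarization, surjectivity of $(X,W)\mapsto X^H+JW^H$ and the formula
for the diagonal. -/
theorem IsAlmostAntiHermitian.isQuasiAntiKahler_iff_cubicForm [FiniteDimensional ℝ E]
    (h : IsAlmostAntiHermitian g K) (hK : K.Smooth) (hC : K.Compatible) :
    IsQuasiAntiKahler g K ↔ ∀ φ ∈ IsManifold.maximalAtlas 𝓘(ℝ, E) ∞ M, ∀ x ∈ φ.target,
      ∀ y X W : E, cubicForm K (metricInChart g φ) (x, y) X W = 0 := by
  refine forall₄_congr fun φ hφ x hx => forall_congr' fun y => ?_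
  have hg := isRiemannianNear_metricInChart g hφ hx
  have hA := h.isAntiHermitianNear hφ hx
  refine (hA.isQuasiAntiKahler_iff (p := (x, y)) hg hK).trans ⟨fun H X W => ?_, fun H u => ?_⟩
  · rw [← tensorF_diag_eq_cubicForm (p := (x, y)) hA hg hK hC, H]
  · obtain ⟨X, W, rfl⟩ := exists_eq_hlift_add_liftJ hC (energy_nonneg (p := (x, y)) hg) u
    rw [tensorF_diag_eq_cubicForm (p := (x, y)) hA hg hK hC, H]

end

end NaturalLift

/-! ### The main equivalence. -/

theorem mainTheorem5 {n : ℕ} (hn : 2 ≤ n)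
    {M : Type*} [TopologicalSpace M] [ChartedSpace (EuclideanSpace ℝ (Fin n)) M]
    [IsManifold 𝓘(ℝ, EuclideanSpace ℝ (Fin n)) ∞ M] [Nonempty M]
    (g : Bundle.ContMDiffRiemannianMetric 𝓘(ℝ, EuclideanSpace ℝ (Fin n)) ∞
      (EuclideanSpace ℝ (Fin n))
      (fun x : M => TangentSpace 𝓘(ℝ, EuclideanSpace ℝ (Fin n)) x))
    (K : NaturalLift.Coeffs) (hK : K.Smooth)
    (hGJ : NaturalLift.IsAlmostAntiHermitian g K)
    (hden : ∀ t : ℝ, 0 ≤ t →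
      K.c1 t * (1 + K.a3 t ^ 2) - K.a1 t * K.a3 t * K.c3 t ≠ 0) :
    NaturalLift.IsQuasiAntiKahler g K ↔
      ∃ c : ℝ, NaturalLift.HasConstantSectionalCurvature g c ∧
        ∀ t : ℝ, 0 ≤ t → K.SatisfiesQuasiRelations c t := by
  have hfin : 2 ≤ Module.finrank ℝ (EuclideanSpace ℝ (Fin n)) := by
    rwa [finrank_euclideanSpace_fin]
  obtain ⟨x₀⟩ := ‹Nonempty M›
  have hφ₀ := IsManifold.chart_mem_maximalAtlas
    (I := 𝓘(ℝ, EuclideanSpace ℝ (Fin n))) (n := ∞) x₀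
  have hx₀ := mem_chart_target (EuclideanSpace ℝ (Fin n)) x₀
  have hg₀ := NaturalLift.isRiemannianNear_metricInChart g hφ₀ hx₀
  have hC := (hGJ.isAntiHermitianNear hφ₀ hx₀).compatible hfin hg₀ hK
  -- $a_1\kappa=-(c_1(1+a_3^2)-a_1a_3c_3)$, nonzero by `hden`; this allows solving for the curvature
  -- at $t=0$.
  have hκ : K.kap 0 ≠ 0 := by
    intro h0
    refine hden 0 le_rfl ?_
    have h1 := hC.c2_eq 0 le_rfl
    have h2 := hC.a1_mul_a2 0 le_rfl
    rw [NaturalLift.Coeffs.kap] at h0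
    linear_combination (-K.a1 0) * h0 + K.a1 0 * h1 - K.c1 0 * h2
  rw [hGJ.isQuasiAntiKahler_iff_cubicForm hK hC]
  constructor
  · intro H
    have hS : NaturalLift.HasConstantSectionalCurvature g K.sectionalCurvature :=
      fun φ hφ x hx => NaturalLift.curvature_of_cubicForm hfin
        (NaturalLift.isRiemannianNear_metricInChart g hφ hx) hK hκ (H φ hφ x hx)
    refine ⟨K.sectionalCurvature, hS, fun t ht => ?_⟩
    rw [← NaturalLift.Coeffs.satisfiesCyclicRelations_iff_quasi hC ht (hden t ht)]
    refine NaturalLift.Coeffs.satisfiesCyclicRelations_of_pos hK (fun s hs => ?_) ht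
    -- The relations involve only $t$, so a single fibre, over `x₀`, already realizes every value
    -- $s>0$.
    obtain ⟨y, rfl⟩ := NaturalLift.exists_energy_eq hfin hg₀ hs.le
    refine NaturalLift.satisfiesCyclicRelations_of_cubicForm hfin hg₀
      (hg₀.curvature_eq (hS _ hφ₀ _ hx₀)) ?_ (H _ hφ₀ _ hx₀ y)
    rintro rfl
    simp [NaturalLift.energy] at hs
  · rintro ⟨c, hS, H⟩ φ hφ x hx y X W
    have hg := NaturalLift.isRiemannianNear_metricInChart g hφ hx
    have ht := NaturalLift.energy_nonneg (p := (x, y)) hg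
    obtain ⟨h1, h2, h3, h4, h5, h6⟩ := (K.satisfiesCyclicRelations_iff c _).1
      ((NaturalLift.Coeffs.satisfiesCyclicRelations_iff_quasi hC ht (hden _ ht)).2 (H _ ht))
    rw [NaturalLift.cubicForm_eq_of_curvature_eq (p := (x, y)) hg.symm.self_of_nhds
      (hg.curvature_eq (hS φ hφ x hx)), h1, h2, h3, h4, h5, h6]
    ring
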